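/- Let $n\ge 0$, let $b_1,\dots,b_{n+1}$ be the standard basis of $\mathbb{C}^{n+1}$, $F_p=\langle b_1,\dots,b_p\rangle$, and identify $\mathbb{C}^p$ with $F_p$. Let $w\in S_{n+1}$, and put $r^w_{p,q}=\#\{k\le q : w(k)\le p\}$ (which is $0$ if $p=0$ or $q=0$). Let $\Gamma$ be the grid quiver with vertices $(p,q)$, $1\le p\le n+1$, $1\le q\le n$, and arrows $(p,q)\to(p+1,q)$ and $(p,q)\to(p,q+1)$, and let $M$ be its representation with $M_{p,q}=\mathbb{C}^p$, the standard inclusions on the arrows $(p,q)\to(p+1,q)$ and the identities on the arrows $(p,q)\to(p,q+1)$. The quiver Grassmannian $\mathrm{Gr}_{\mathbf r^w}(M)$ is the variety of subrepresentations $R=(R_{p,q})$ of $M$ with $\dim R_{p,q}=r^w_{p,q}$, a closed subvariety of a product of Grassmannians. Call a vertex $(p,q)$ *free* if $r^w_{p,q}<p$, $r^w_{p,q}>r^w_{p-1,q}$ and $r^w_{p,q}>r^w_{p,q-1}$. Let $w=s_{c_1}s_{c_2}\cdots s_{c_N}$ be a reduced decomposition ($N=\ell(w)$, $s_i$ the transposition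 of $i$ and $i+1$, permutations composed as functions) that is *geometrically compatible*: the multiset $[c_1,\dots,c_N]$ equals the multiset of the numbers $r^w_{p,q}$ over all free vertices $(p,q)$. Let $\mathrm{BS}(s_{c_1}\cdots s_{c_N})$ be the Bott–Samelson variety of all sequences $(V^0_\bullet,\dots,V^N_\bullet)$ of complete flags in $\mathbb{C}^{n+1}$ such that $V^0_\bullet=F_\bullet$ and $V^{k-1}_i=V^k_i$ for all $1\le k\le N$ and all $i\ne c_k$. Then there is a bijection $\varphi$ from $\{1,\dots,N\}$ to the set of free vertices such that, writing $\varphi(k)=(p(k),q(k))$, one has $r^w_{p(k),q(k)}=c_k$ for all $k$, and $p(j)<p(k)$ whenever $j<k$ and $c_j=c_k$; and there is an isomorphism of complex algebraic varieties $$\Phi:\mathrm{BS}(s_{c_1}\cdots s_{c_N})\ \xrightarrow{\ \sim\ }\ \mathrm{Gr}_{\mathbf r^w}(M)$$ such that $R=\Phi(V)$ satisfies $R_{p(k),q(k)}=V^k_{c_k}$ for all $k=1,\dots,N$, and $R_{n+1,q}=V^N_q$ for all $q=1,\dots,n$. -/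

import Mathlib

namespace QuiverGr

/-! ### Products of Grassmannians as algebraic varieties over `ℂ` -/

/-- The Grassmannian of `d`-dimensional subspaces of `ℂ^m` (as a set of points). -/
def Gr (d m : ℕ) : Type :=
  {W : Submodule ℂ (Fin m → ℂ) // Module.finrank ℂ W = d}

/-- A basis of a point of the Grassmannian. -/
noncomputable def Gr.frame {d m : ℕ} (W : Gr d m) : Module.Basis (Fin d) ℂ W.1 :=
  Module.finBasisOfFinrankEq ℂ W.1 W.2

/-- The Plücker coordinates of `W`: the `d × d` minors of an `m × d` matrix whose columns are a
basis of `W`. Up to a common nonzero factor they do not depend on the basis. -/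
noncomputable def Gr.plucker {d m : ℕ} (W : Gr d m) (σ : Fin d → Fin m) : ℂ :=
  Matrix.det (Matrix.of fun a b : Fin d => (W.frame b : Fin m → ℂ) (σ a))

/-- The product of the Grassmannians `Gr(d i, ℂ^(m i))`. -/
def ProdGr {ι : Type} (d m : ι → ℕ) : Type := ∀ i, Gr (d i) (m i)

/-- The index set of all Plücker coordinates on a product of Grassmannians. -/
abbrev PluckerVar {ι : Type} (d m : ι → ℕ) : Type := Σ i, (Fin (d i) → Fin (m i))

section Product

variable {ι : Type} {d m : ι → ℕ}

/-- All Plücker coordinates of a point, that is, multihomogeneous coordinates of its image in the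
product of projective spaces. -/
noncomputable def ProdGr.coords (x : ProdGr d m) : PluckerVar d m → ℂ :=
  fun v => (x v.1).plucker v.2

/-- `P` is multihomogeneous of multidegree `e`: of degree `e i` in the Plücker coordinates of the
`i`-th factor, for every `i`. -/
def IsMultiHom (P : MvPolynomial (PluckerVar d m) ℂ) (e : ι →₀ ℕ) : Prop :=
  MvPolynomial.IsWeightedHomogeneous (fun v : PluckerVar d m => Finsupp.single v.1 1) P e

/-- The Zariski topology: the nonvanishing loci of the multihomogeneous polynomials in the Plücker
coordinates form a basis. -/
instance : TopologicalSpace (ProdGr d m) :=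
  TopologicalSpace.generateFrom
    {U | ∃ (P : MvPolynomial (PluckerVar d m) ℂ) (e : ι →₀ ℕ), IsMultiHom P e ∧
      U = {x | MvPolynomial.eval x.coords P ≠ 0}}

/-- `φ` is a regular function on the open subset `U` of `X`: locally on `U` it is a quotient of
two multihomogeneous polynomials of the same multidegree. -/
def IsRegularOn {X : Set (ProdGr d m)} (U : Set X) (φ : X → ℂ) : Prop :=
  ∀ x ∈ U, ∃ O : Set X, IsOpen O ∧ x ∈ O ∧ O ⊆ U ∧
    ∃ (P Q : MvPolynomial (PluckerVar d m) ℂ) (e : ι →₀ ℕ), IsMultiHom P e ∧ IsMultiHom Q e ∧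
      ∀ y ∈ O, MvPolynomial.eval y.1.coords Q ≠ 0 ∧
        φ y = MvPolynomial.eval y.1.coords P / MvPolynomial.eval y.1.coords Q

/-- Morphisms of varieties: continuous maps that pull regular functions on open subsets back to
regular functions. -/
def IsMorphism {κ : Type} {d' m' : κ → ℕ} {X : Set (ProdGr d m)} {Y : Set (ProdGr d' m')}
    (f : X → Y) : Prop :=
  Continuous f ∧ ∀ U : Set Y, IsOpen U → ∀ φ : Y → ℂ, IsRegularOn U φ →
    IsRegularOn (f ⁻¹' U) (φ ∘ f)

/-- Isomorphisms of varieties: bijections that are morphisms in both directions. -/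
def IsVarietyIso {κ : Type} {d' m' : κ → ℕ} {X : Set (ProdGr d m)} {Y : Set (ProdGr d' m')}
    (f : X ≃ Y) : Prop :=
  IsMorphism f ∧ IsMorphism f.symm

end Product

/-! ### Quiver representations and quiver Grassmannians -/

/-- A representation over `ℂ` of a quiver, with the space `ℂ^(dim v)` at the vertex `v`. -/
structure Rep (Q : Type) [Quiver.{0} Q] where
  /-- The dimension vector. -/
  dim : Q → ℕ
  /-- The linear maps attached to the arrows. -/
  map : ∀ {a b : Q}, (a ⟶ b) → (Fin (dim a) → ℂ) →ₗ[ℂ] (Fin (dim b) → ℂ)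

/-- The quiver Grassmannian `Gr_e(M)`: the subrepresentations of `M` of dimension vector `e`, inside
the product of the Grassmannians `Gr(e v, M_v)`. -/
def quiverGrassmannian {Q : Type} [Quiver.{0} Q] (M : Rep Q) (e : Q → ℕ) :
    Set (ProdGr e M.dim) :=
  {R | ∀ (a b : Q) (α : a ⟶ b), (R a).1.map (M.map α) ≤ (R b).1}

/-- The vertices of the grid with `n + 1` rows and `n` columns. The pair `(i, j)` of indices
starting from `0` is the vertex in row `i + 1` and column `j + 1`. -/
def GridVertex (n : ℕ) : Type := Fin (n + 1) × Fin n

/-- The row of a vertex (starting from `1`). -/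
def GridVertex.row {n : ℕ} (v : GridVertex n) : ℕ := v.1.val + 1

/-- The column of a vertex (starting from `1`). -/
def GridVertex.col {n : ℕ} (v : GridVertex n) : ℕ := v.2.val + 1

instance (n : ℕ) : Fintype (GridVertex n) := inferInstanceAs (Fintype (Fin (n + 1) × Fin n))

/-- The arrows of the grid: one step down or one step to the right. -/
inductive GridArrow (n : ℕ) : GridVertex n → GridVertex n → Type
  | down (i i' : Fin (n + 1)) (j : Fin n) (h : i'.val = i.val + 1) : GridArrow n (i, j) (i', j)
  | right (i : Fin (n + 1)) (j j' : Fin n) (h : j'.val = j.val + 1) : GridArrow n (i, j) (i, j')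

instance (n : ℕ) : Quiver.{0} (GridVertex n) := ⟨GridArrow n⟩

/-- The inclusion of `ℂ^a` into `ℂ^b` as the span of the first `a` basis vectors. -/
noncomputable def incl {a b : ℕ} (h : a ≤ b) : (Fin a → ℂ) →ₗ[ℂ] (Fin b → ℂ) :=
  Function.ExtendByZero.linearMap ℂ (Fin.castLE h)

/-- The linear maps of the grid representation: inclusions downwards, identities to the right. -/
noncomputable def gridMap (n : ℕ) : ∀ {a b : GridVertex n}, GridArrow n a b →
    (Fin a.row → ℂ) →ₗ[ℂ] (Fin b.row → ℂ)
  | _, _, .down i i' _ h => incl (a := i.val + 1) (b := i'.val + 1) (by omega)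
  | _, _, .right _ _ _ _ => LinearMap.id

/-- The representation `M` of the grid with `ℂ^i` at each vertex of the `i`-th row. -/
noncomputable def gridRep (n : ℕ) : Rep (GridVertex n) where
  dim v := v.row
  map α := gridMap n α

/-! ### Permutations -/

/-- `r^w_{p,q} = #{k ≤ q : w(k) ≤ p}`, where `p` and `q` start from `1`. (Elements of `Fin (n + 1)`
start from `0`.) It is `0` for `p = 0` and for `q = 0`. -/
def rk {n : ℕ} (w : Equiv.Perm (Fin (n + 1))) (p q : ℕ) : ℕ :=
  (Finset.univ.filter fun k : Fin (n + 1) => k.val + 1 ≤ q ∧ (w k).val + 1 ≤ p).card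

/-- The dimension vector `r^w` on the grid. -/
def rkVec {n : ℕ} (w : Equiv.Perm (Fin (n + 1))) (v : GridVertex n) : ℕ := rk w v.row v.col

/-- The vertices `(p, q)` with `r^w_{p,q} < p`, `r^w_{p,q} > r^w_{p-1,q}` and
`r^w_{p,q} > r^w_{p,q-1}`. -/
def freeCells {n : ℕ} (w : Equiv.Perm (Fin (n + 1))) : Finset (GridVertex n) :=
  Finset.univ.filter fun v => rk w v.row v.col < v.row ∧
    rk w (v.row - 1) v.col < rk w v.row v.col ∧ rk w v.row (v.col - 1) < rk w v.row v.col

/-- The simple transposition that swaps `i` and `i + 1`. -/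
def simpleTransp {n : ℕ} (i : Fin n) : Equiv.Perm (Fin (n + 1)) :=
  Equiv.swap i.castSucc i.succ

/-- The length of a permutation: its number of inversions. -/
def length {n : ℕ} (w : Equiv.Perm (Fin (n + 1))) : ℕ :=
  (Finset.univ.filter fun x : Fin (n + 1) × Fin (n + 1) => x.1 < x.2 ∧ w x.2 < w x.1).card

/-- `w = s_{c_1} s_{c_2} ⋯ s_{c_N}` is a reduced decomposition (letters in the order in which the
product is written; permutations are composed as functions). -/
def IsReducedDecomposition {n N : ℕ} (w : Equiv.Perm (Fin (n + 1))) (c : Fin N → Fin n) : Prop :=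
  w = (List.ofFn fun k => simpleTransp (c k)).prod ∧ N = length w

/-- The reduced decomposition `c` of `w` is geometrically compatible: its multiset of indices
(starting from `1`) is the multiset of the numbers `r^w_{p,q}` over the free cells `(p, q)`. -/
def IsGeomCompatible {n N : ℕ} (w : Equiv.Perm (Fin (n + 1))) (c : Fin N → Fin n) : Prop :=
  IsReducedDecomposition w c ∧
    (Finset.univ : Finset (Fin N)).val.map (fun k => (c k).val + 1) =
      (freeCells w).val.map (rkVec w)

/-! ### Bott–Samelson varieties -/

/-- The subspace spanned by the first `p` standard basis vectors of `ℂ^(n+1)`. -/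
def stdSubspace (n p : ℕ) : Submodule ℂ (Fin (n + 1) → ℂ) :=
  Submodule.span ℂ {v | ∃ t : Fin (n + 1), t.val < p ∧ v = Pi.single t 1}

/-- The Bott–Samelson variety of the word `s_{c_1} ⋯ s_{c_N}`: sequences `V^0, …, V^N` of complete
flags in `ℂ^(n+1)` that start at the standard flag and such that `V^{k-1}` and `V^k` differ at most
in the subspace of dimension `c_k`. The proper nonzero subspace of dimension `i + 1` of the flag
`V^k` is `V (k, i)`. -/
def bottSamelson {n N : ℕ} (c : Fin N → Fin n) :
    Set (ProdGr (fun x : Fin (N + 1) × Fin n => x.2.val + 1) (fun _ => n + 1)) :=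
  {V | (∀ k i j, i ≤ j → (V (k, i)).1 ≤ (V (k, j)).1) ∧
    (∀ i, (V (0, i)).1 = stdSubspace n (i.val + 1)) ∧
    ∀ (k : Fin N) (i : Fin n), i ≠ c k → (V (k.castSucc, i)).1 = (V (k.succ, i)).1}

/-- The component `R_{p,q} ⊆ ℂ^p` of a tuple of subspaces on the grid, regarded as a subspace of
`ℂ^(n+1)`. -/
noncomputable def comp {n : ℕ} {e : GridVertex n → ℕ} (R : ProdGr e (gridRep n).dim)
    (v : GridVertex n) : Submodule ℂ (Fin (n + 1) → ℂ) :=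
  (R v).1.map (incl (a := v.row) (b := n + 1) v.1.isLt)

end QuiverGr

/-! Follow the prefixes of the reduced word. The `k`-th letter exchanges two neighbouring values x <
y, and the pairs (x, y) are exactly the inversions of `w`. Attach to the letter the cell in row y
whose column is the last position before that of x in `w` carrying a value at most y. This cell is
free, distinct letters give distinct cells, and compatibility supplies equally many free cells, so
the assignment is a bijection.

The rank at the cell is one more than the number of v < y that precede x in `w`, while the letter is
one more than the number of values standing left of x at the moment of exchange. A priori these two
sets of values differ (`leftValues`, `finalLeftValues`). Compatibility equates the sums of their
sizes. Each value in the second set but not in the first produces two discrepancies of the opposite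
kind, injectively, so equal sums force equal sets (`IsReducedDecomposition.leftValues_eq`). Hence
rank equals letter, and everything left of an exchange is smaller than y. This gives
`IsReducedDecomposition.letter_order`: letters that are equal or differ by one occur in order of
increasing row, and of decreasing letter within a row.

Only such letters matter for an inclusion between subspaces of dimensions i and i + 1. So the
inclusions among the flags, indexed by initial segments of the word, are equivalent to those
obtained by installing the subspaces row by row (`LabelOrder.lastVal_upToLabel_le`,
`LabelOrder.lastVal_initial_le`). The latter are the conditions on a subrepresentation, whose
component at any vertex is zero, all of the coordinate subspace, or copied from a free cell
(`IsCellLabelling.comp_eq_currentSubspace`). In both directions every component of the map is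
constant or a component of the argument, up to a coordinate inclusion, which makes it polynomial in
Plücker coordinates. -/

namespace QuiverGr

open Finset

/-! ### Reduced words and inversions -/

section Words

variable {n N : ℕ}

/-- The product of the first `k` letters of a word. -/
def prefixProd (c : Fin N → Fin n) (k : ℕ) : Equiv.Perm (Fin (n + 1)) :=
  ((List.ofFn fun k => simpleTransp (c k)).take k).prod

/-- The position of the value `v` after `k` letters of a word. -/
def pos (c : Fin N → Fin n) (k : ℕ) (v : Fin (n + 1)) : Fin (n + 1) :=
  (prefixProd c k).symm v

/-- The value that the `k`-th letter moves to the right. -/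
def lowValue (c : Fin N → Fin n) (k : Fin N) : Fin (n + 1) := prefixProd c k (c k).castSucc

/-- The value that the `k`-th letter moves to the left. -/
def highValue (c : Fin N → Fin n) (k : Fin N) : Fin (n + 1) := prefixProd c k (c k).succ

/-- The inversions of a permutation, as pairs of values. -/
def valueInversions (u : Equiv.Perm (Fin (n + 1))) : Finset (Fin (n + 1) × Fin (n + 1)) :=
  univ.filter fun x => x.1 < x.2 ∧ u.symm x.2 < u.symm x.1

lemma card_valueInversions (u : Equiv.Perm (Fin (n + 1))) :
    (valueInversions u).card = length u := by
  unfold valueInversions length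
  refine Finset.card_bij' (fun x _ => (u.symm x.2, u.symm x.1)) (fun x _ => (u x.2, u x.1))
    ?_ ?_ ?_ ?_ <;> simp <;> tauto

lemma prefixProd_zero (c : Fin N → Fin n) : prefixProd c 0 = 1 := by simp [prefixProd]

lemma prefixProd_succ (c : Fin N → Fin n) (k : Fin N) :
    prefixProd c (k + 1) = prefixProd c k * simpleTransp (c k) := by
  unfold prefixProd
  rw [List.prod_take_succ _ _ (by simp)]
  simp

lemma prefixProd_full (c : Fin N → Fin n) :
    prefixProd c N = (List.ofFn fun k => simpleTransp (c k)).prod := by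
  unfold prefixProd
  rw [List.take_of_length_le (by simp)]

lemma pos_injective (c : Fin N → Fin n) (k : ℕ) : Function.Injective (pos c k) :=
  (prefixProd c k).symm.injective

lemma pos_lowValue (c : Fin N → Fin n) (k : Fin N) :
    pos c k (lowValue c k) = (c k).castSucc := by simp [pos, lowValue]

lemma pos_highValue (c : Fin N → Fin n) (k : Fin N) :
    pos c k (highValue c k) = (c k).succ := by simp [pos, highValue]

lemma pos_succ (c : Fin N → Fin n) (k : Fin N) (v : Fin (n + 1)) :
    pos c (k + 1) v = simpleTransp (c k) (pos c k v) := by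
  unfold pos
  rw [prefixProd_succ]
  simp [Equiv.Perm.mul_def, simpleTransp]

lemma pos_succ_lowValue (c : Fin N → Fin n) (k : Fin N) :
    pos c (k + 1) (lowValue c k) = (c k).succ := by
  rw [pos_succ, pos_lowValue]; simp [simpleTransp]

lemma pos_succ_highValue (c : Fin N → Fin n) (k : Fin N) :
    pos c (k + 1) (highValue c k) = (c k).castSucc := by
  rw [pos_succ, pos_highValue]; simp [simpleTransp]

lemma lowValue_ne_highValue (c : Fin N → Fin n) (k : Fin N) : lowValue c k ≠ highValue c k := by
  intro h
  have := congrArg (pos c k) h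
  rw [pos_lowValue, pos_highValue] at this
  exact absurd this (Fin.castSucc_lt_succ).ne

lemma simpleTransp_lt_iff (i : Fin n) {p q : Fin (n + 1)}
    (h : ¬(p = i.castSucc ∧ q = i.succ)) (h' : ¬(p = i.succ ∧ q = i.castSucc)) :
    simpleTransp i p < simpleTransp i q ↔ p < q := by
  simp only [simpleTransp, Equiv.swap_apply_def, Fin.ext_iff, Fin.val_castSucc, Fin.val_succ,
    Fin.lt_def] at *
  split_ifs <;> simp <;> omega

lemma pos_succ_lt_iff (c : Fin N → Fin n) (k : Fin N) {a b : Fin (n + 1)}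
    (h : ¬(a = lowValue c k ∧ b = highValue c k)) (h' : ¬(a = highValue c k ∧ b = lowValue c k)) :
    pos c (k + 1) a < pos c (k + 1) b ↔ pos c k a < pos c k b := by
  rw [pos_succ, pos_succ]
  apply simpleTransp_lt_iff
  · rw [← pos_lowValue, ← pos_highValue, (pos_injective c k).eq_iff, (pos_injective c k).eq_iff]
    exact h
  · rw [← pos_lowValue, ← pos_highValue, (pos_injective c k).eq_iff, (pos_injective c k).eq_iff]
    exact h'

lemma mem_valueInversions_prefixProd {c : Fin N → Fin n} {k : ℕ} {a b : Fin (n + 1)} :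
    (a, b) ∈ valueInversions (prefixProd c k) ↔ a < b ∧ pos c k b < pos c k a := by
  simp [valueInversions, pos]

lemma card_valueInversions_prefixProd_succ_le (c : Fin N → Fin n) (k : Fin N) :
    (valueInversions (prefixProd c (k + 1))).card ≤
      (valueInversions (prefixProd c k)).card + 1 := by
  refine (Finset.card_le_card (t := insert (lowValue c k, highValue c k)
    (valueInversions (prefixProd c k))) ?_).trans (Finset.card_insert_le _ _)
  rintro ⟨a, b⟩ hab
  rw [mem_insert, mem_valueInversions_prefixProd] at *
  by_cases h : a = lowValue c k ∧ b = highValue c k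
  · exact Or.inl (by rw [h.1, h.2])
  · refine Or.inr ⟨hab.1, ?_⟩
    by_cases h' : b = lowValue c k ∧ a = highValue c k
    · rw [h'.1, h'.2, pos_lowValue, pos_highValue]; exact Fin.castSucc_lt_succ
    · rw [← pos_succ_lt_iff c k h' (by tauto)]; exact hab.2

lemma card_valueInversions_prefixProd_succ_le_of_lt (c : Fin N → Fin n) (k : Fin N)
    (hk : highValue c k < lowValue c k) :
    (valueInversions (prefixProd c (k + 1))).card ≤ (valueInversions (prefixProd c k)).card := by
  refine Finset.card_le_card ?_
  rintro ⟨a, b⟩ hab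
  rw [mem_valueInversions_prefixProd] at *
  refine ⟨hab.1, ?_⟩
  by_cases h' : b = lowValue c k ∧ a = highValue c k
  · rw [h'.1, h'.2, pos_lowValue, pos_highValue]; exact Fin.castSucc_lt_succ
  · refine (pos_succ_lt_iff c k h' ?_).1 hab.2
    rintro ⟨rfl, rfl⟩
    exact absurd hab.1 hk.asymm

end Words

/-! ### Crossings in a reduced word and the order of its letters -/

section Reduced

variable {n N : ℕ} {w : Equiv.Perm (Fin (n + 1))} {c : Fin N → Fin n}

lemma IsReducedDecomposition.prefixProd_eq (h : IsReducedDecomposition w c) :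
    prefixProd c N = w := by rw [prefixProd_full, h.1]

lemma IsReducedDecomposition.pos_eq (h : IsReducedDecomposition w c) (v : Fin (n + 1)) :
    pos c N v = w.symm v := by rw [pos, h.prefixProd_eq]

lemma IsReducedDecomposition.low_lt_high (h : IsReducedDecomposition w c) (k : Fin N) :
    lowValue c k < highValue c k := by
  by_contra hk
  have hk : highValue c k < lowValue c k :=
    lt_of_le_of_ne (not_lt.1 hk) (lowValue_ne_highValue c k).symm
  -- Each letter adds at most one inversion and the letter `k` would add none, so the whole word
  -- would reach fewer than `N` inversions.
  have up : ∀ m, m ≤ N → (valueInversions (prefixProd c m)).card + (if (k : ℕ) < m then 1 else 0)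
      ≤ m := by
    intro m
    induction m with
    | zero => intro _; simp [prefixProd_zero, valueInversions]; intro a b h1; exact h1.le
    | succ m ih =>
      intro hm
      have ih := ih (by omega)
      have h1 := card_valueInversions_prefixProd_succ_le c ⟨m, hm⟩
      by_cases hmk : m = k
      · subst hmk
        have h2 := card_valueInversions_prefixProd_succ_le_of_lt c k hk
        simp only [lt_irrefl, if_false, Nat.lt_succ_self, if_true] at *
        omega
      · simp only at h1
        split_ifs at * <;> omega
  have := up N le_rfl
  rw [h.prefixProd_eq, card_valueInversions, if_pos k.2, ← h.2] at this
  omega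

/-- Every exchange moves the larger value to the left, so a pair that has crossed never crosses
back. -/
lemma IsReducedDecomposition.inverted_mono (h : IsReducedDecomposition w c) {a b : Fin (n + 1)}
    (hab : a < b) {j k : ℕ} (hjk : j ≤ k) (hk : k ≤ N) (hj : pos c j b < pos c j a) :
    pos c k b < pos c k a := by
  induction k, hjk using Nat.le_induction with
  | base => exact hj
  | succ k hjk ih =>
    have ih := ih (by omega)
    by_cases h' : b = highValue c ⟨k, hk⟩ ∧ a = lowValue c ⟨k, hk⟩
    · rw [h'.1, h'.2]
      rw [pos_succ_lowValue c ⟨k, hk⟩, pos_succ_highValue c ⟨k, hk⟩]; exact Fin.castSucc_lt_succ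
    · refine (pos_succ_lt_iff c ⟨k, hk⟩ ?_ h').2 ih
      rintro ⟨rfl, rfl⟩
      exact absurd hab (h.low_lt_high ⟨k, hk⟩).asymm

lemma IsReducedDecomposition.not_inverted_anti (h : IsReducedDecomposition w c) {a b : Fin (n + 1)}
    (hab : a < b) {j k : ℕ} (hjk : j ≤ k) (hk : k ≤ N) (hj : pos c k a < pos c k b) :
    pos c j a < pos c j b := by
  by_contra h'
  refine absurd hj (h.inverted_mono hab hjk hk (lt_of_le_of_ne (not_lt.1 h') ?_)).asymm
  exact fun e => hab.ne' (pos_injective c j e)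

lemma pos_low_lt_pos_high (c : Fin N → Fin n) (k : Fin N) :
    pos c k (lowValue c k) < pos c k (highValue c k) := by
  rw [pos_lowValue, pos_highValue]; exact Fin.castSucc_lt_succ

lemma pos_succ_high_lt_pos_succ_low (c : Fin N → Fin n) (k : Fin N) :
    pos c (k + 1) (highValue c k) < pos c (k + 1) (lowValue c k) := by
  rw [pos_succ_lowValue, pos_succ_highValue]; exact Fin.castSucc_lt_succ

lemma IsReducedDecomposition.pair_injective (h : IsReducedDecomposition w c) :
    Function.Injective fun k => (lowValue c k, highValue c k) := by
  have key : ∀ j k : Fin N, (lowValue c j, highValue c j) = (lowValue c k, highValue c k) →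
      ¬ j < k := by
    intro j k e hjk
    rw [Prod.mk.injEq] at e
    have h1 := pos_succ_high_lt_pos_succ_low c j
    have h2 := h.inverted_mono (h.low_lt_high j) (show (j : ℕ) + 1 ≤ k from hjk) k.2.le h1
    rw [e.1, e.2] at h2
    exact absurd h2 (pos_low_lt_pos_high c k).asymm
  intro j k e
  exact le_antisymm (not_lt.1 (key k j e.symm)) (not_lt.1 (key j k e))

lemma IsReducedDecomposition.symm_high_lt_symm_low (h : IsReducedDecomposition w c) (k : Fin N) :
    w.symm (highValue c k) < w.symm (lowValue c k) := by
  rw [← h.pos_eq, ← h.pos_eq]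
  exact h.inverted_mono (h.low_lt_high k) (show (k : ℕ) + 1 ≤ N from k.2) le_rfl
    (pos_succ_high_lt_pos_succ_low c k)

/-- The letters give `N` distinct inversions and `w` has only `N` of them. -/
lemma IsReducedDecomposition.exists_crossing (h : IsReducedDecomposition w c) {a b : Fin (n + 1)}
    (hab : a < b) (hw : w.symm b < w.symm a) : ∃ k, lowValue c k = a ∧ highValue c k = b := by
  have himg : univ.image (fun k => (lowValue c k, highValue c k)) = valueInversions w := by
    apply Finset.eq_of_subset_of_card_le
    · intro x hx
      obtain ⟨k, -, rfl⟩ := mem_image.1 hx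
      simp [valueInversions, h.low_lt_high k, h.symm_high_lt_symm_low k]
    · rw [Finset.card_image_of_injective _ h.pair_injective, card_valueInversions, ← h.2]
      simp
  have : (a, b) ∈ valueInversions w := by simp [valueInversions, hab, hw]
  rw [← himg] at this
  obtain ⟨k, -, hk⟩ := mem_image.1 this
  rw [Prod.mk.injEq] at hk
  exact ⟨k, hk⟩

/-- The values to the left of the two values that the `k`-th letter exchanges. -/
def leftValues (c : Fin N → Fin n) (k : Fin N) : Finset (Fin (n + 1)) :=
  univ.filter fun v => pos c k v < pos c k (lowValue c k)

/-- The values to the left of the two values that the `k`-th letter exchanges, if the larger one of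
them travels through a rearrangement of the smaller values that is already complete. -/
def finalLeftValues (w : Equiv.Perm (Fin (n + 1))) (c : Fin N → Fin n) (k : Fin N) :
    Finset (Fin (n + 1)) :=
  univ.filter fun v => v < highValue c k ∧ w.symm v < w.symm (lowValue c k)

lemma card_pos_lt (c : Fin N → Fin n) (k : ℕ) {m : ℕ} (hm : m ≤ n + 1) :
    (univ.filter fun v => (pos c k v : ℕ) < m).card = m := by
  have : (univ.filter fun v => (pos c k v : ℕ) < m).card =
      (univ.filter fun v : Fin (n + 1) => (v : ℕ) < m).card := by
    refine Finset.card_bij' (fun v _ => pos c k v) (fun v _ => prefixProd c k v) ?_ ?_ ?_ ?_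
    · intro a ha; simpa using ha
    · intro a ha; exact mem_filter.2 ⟨mem_univ _, by simpa [pos] using ha⟩
    · simp [pos]
    · simp [pos]
  rw [this, Fin.card_filter_val_lt]
  omega

lemma card_leftValues (c : Fin N → Fin n) (k : Fin N) : (leftValues c k).card = c k := by
  rw [← card_pos_lt c k (show (c k : ℕ) ≤ n + 1 by omega)]
  simp [leftValues, pos_lowValue, Fin.lt_def]

/-- The triples of the two values that a letter exchanges and a further value from a set that
depends on the letter. -/
def crossingTriples (c : Fin N → Fin n) (B : Fin N → Finset (Fin (n + 1))) :
    Finset (Fin (n + 1) × Fin (n + 1) × Fin (n + 1)) :=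
  (univ.sigma B).image fun x => (lowValue c x.1, highValue c x.1, x.2)

lemma IsReducedDecomposition.card_crossingTriples (h : IsReducedDecomposition w c)
    (B : Fin N → Finset (Fin (n + 1))) :
    (crossingTriples c B).card = ∑ k, (B k).card := by
  rw [crossingTriples, Finset.card_image_of_injective, Finset.card_sigma]
  rintro ⟨j, a⟩ ⟨k, b⟩ e
  simp only [Prod.mk.injEq] at e
  obtain rfl := h.pair_injective (a₁ := j) (a₂ := k) (by simp [e.1, e.2.1])
  rw [e.2.2]

lemma IsReducedDecomposition.mem_crossingTriples (h : IsReducedDecomposition w c)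
    (B : Fin N → Finset (Fin (n + 1))) (k : Fin N) (v : Fin (n + 1)) :
    (lowValue c k, highValue c k, v) ∈ crossingTriples c B ↔ v ∈ B k := by
  simp only [crossingTriples, mem_image, mem_sigma, mem_univ, true_and, Prod.mk.injEq, Sigma.exists]
  constructor
  · rintro ⟨j, a, ha, h1, h2, rfl⟩
    obtain rfl := h.pair_injective (a₁ := j) (a₂ := k) (by simp [h1, h2])
    exact ha
  · intro hv
    exact ⟨k, v, hv, rfl, rfl, rfl⟩

/-- Write x < y for the exchanged values. At time `k` the value v is right of x, yet in `w` it
precedes x, so x < v < y and the three values end in the order y, v, x. Since v also stands right of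
y, the pairs crossed in the order (v, y), (x, y), (x, v). In the first crossing x is on the left but
ends right of v; in the last one y is on the left but exceeds v. Both are discrepancies of the
opposite kind. -/
lemma IsReducedDecomposition.unexpected_triple (h : IsReducedDecomposition w c) {k : Fin N}
    {v : Fin (n + 1)} (hv : v ∈ finalLeftValues w c k) (hv' : v ∉ leftValues c k) :
    lowValue c k < v ∧ v < highValue c k ∧
      (∃ j, lowValue c j = v ∧ highValue c j = highValue c k ∧
        lowValue c k ∈ leftValues c j ∧ lowValue c k ∉ finalLeftValues w c j) ∧
      ∃ j, lowValue c j = lowValue c k ∧ highValue c j = v ∧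
        highValue c k ∈ leftValues c j ∧ highValue c k ∉ finalLeftValues w c j := by
  simp only [finalLeftValues, leftValues, mem_filter, mem_univ, true_and, not_lt, not_and] at *
  obtain ⟨hvy, hvx⟩ := hv
  have hne : v ≠ lowValue c k := by rintro rfl; exact lt_irrefl _ hvx
  have hlt : pos c k (lowValue c k) < pos c k v :=
    lt_of_le_of_ne hv' fun e => hne (pos_injective c k e).symm
  have hxv : lowValue c k < v := by
    by_contra hc
    have := h.inverted_mono (lt_of_le_of_ne (not_lt.1 hc) hne) k.2.le le_rfl hlt
    rw [h.pos_eq, h.pos_eq] at this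
    exact absurd this hvx.asymm
  -- The two exchanged values are adjacent, so whatever is right of the smaller one is right of
  -- both.
  have hyv : pos c k (highValue c k) < pos c k v := by
    have h1 : pos c k v ≠ pos c k (highValue c k) := fun e => hvy.ne (pos_injective c k e)
    rw [pos_lowValue] at hlt
    rw [pos_highValue] at h1 ⊢
    rw [Fin.lt_def] at *
    rw [Ne, Fin.ext_iff] at h1
    simp at *
    omega
  have hyv' : w.symm (highValue c k) < w.symm v := by
    rw [← h.pos_eq, ← h.pos_eq]; exact h.inverted_mono hvy k.2.le le_rfl hyv
  refine ⟨hxv, hvy, ?_, ?_⟩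
  · obtain ⟨j, rfl, hj⟩ := h.exists_crossing hvy hyv'
    refine ⟨j, rfl, hj, ?_, fun _ => hvx.le⟩
    have hjk : (j : ℕ) ≤ k := by
      by_contra hc
      have := h.inverted_mono hvy (not_le.1 hc).le j.2.le hyv
      rw [← hj] at this
      exact absurd this (pos_low_lt_pos_high c j).asymm
    exact h.not_inverted_anti hxv hjk k.2.le hlt
  · obtain ⟨j, hj, rfl⟩ := h.exists_crossing hxv hvx
    refine ⟨j, hj, rfl, ?_, fun h' => absurd h' hvy.asymm⟩
    have hjk : (k : ℕ) ≤ j := by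
      by_contra hc
      have := h.inverted_mono hxv (show (j : ℕ) + 1 ≤ k by omega) k.2.le
        (by rw [← hj]; exact pos_succ_high_lt_pos_succ_low c j)
      exact absurd this hlt.asymm
    have hne : (k : ℕ) ≠ j := by
      intro e
      obtain rfl := Fin.ext e
      exact lt_irrefl _ hvy
    rw [hj]
    exact h.inverted_mono (h.low_lt_high k) (show (k : ℕ) + 1 ≤ j by omega) j.2.le
      (pos_succ_high_lt_pos_succ_low c k)

/-- Double counting: the two injections of `T' \ T` into `T \ T'` from `unexpected_triple` have
disjoint images, so the second set is at least twice as large as the first. As `T` and `T'` have the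
same size, both differences are empty. -/
lemma IsReducedDecomposition.leftValues_eq (h : IsReducedDecomposition w c)
    (hsum : ∑ k, (leftValues c k).card = ∑ k, (finalLeftValues w c k).card) (k : Fin N) :
    leftValues c k = finalLeftValues w c k := by
  set T := crossingTriples c (leftValues c) with hT
  set T' := crossingTriples c (finalLeftValues w c) with hT'
  have hcard : T.card = T'.card := by
    rw [hT, hT', h.card_crossingTriples, h.card_crossingTriples, hsum]
  have hD : ∀ t ∈ T' \ T, t.1 < t.2.2 ∧ t.2.2 < t.2.1 ∧ (t.2.2, t.2.1, t.1) ∈ T \ T' ∧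
      (t.1, t.2.2, t.2.1) ∈ T \ T' := by
    intro t ht
    rw [mem_sdiff] at ht
    obtain ⟨⟨k, v⟩, hk, rfl⟩ := mem_image.1 ht.1
    rw [mem_sigma] at hk
    obtain ⟨h1, h2, ⟨i, hi1, hi2, hi3, hi4⟩, j, hj1, hj2, hj3, hj4⟩ := h.unexpected_triple hk.2
      (fun hv => ht.2 ((h.mem_crossingTriples _ _ _).2 hv))
    dsimp only at *
    refine ⟨h1, h2, ?_, ?_⟩
    · rw [mem_sdiff, ← hi1, ← hi2, h.mem_crossingTriples, h.mem_crossingTriples]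
      exact ⟨hi3, hi4⟩
    · rw [mem_sdiff, ← hj1, ← hj2, h.mem_crossingTriples, h.mem_crossingTriples]
      exact ⟨hj3, hj4⟩
  have h1 : ((T' \ T).image fun t => (t.2.2, t.2.1, t.1)) ⊆ T \ T' := by
    intro s hs
    obtain ⟨t, ht, rfl⟩ := mem_image.1 hs
    exact (hD t ht).2.2.1
  have h2 : ((T' \ T).image fun t => (t.1, t.2.2, t.2.1)) ⊆ T \ T' := by
    intro s hs
    obtain ⟨t, ht, rfl⟩ := mem_image.1 hs
    exact (hD t ht).2.2.2
  -- The third entry is smaller than the first in one image and larger in the other.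
  have hdisj : Disjoint ((T' \ T).image fun t => (t.2.2, t.2.1, t.1))
      ((T' \ T).image fun t => (t.1, t.2.2, t.2.1)) := by
    rw [Finset.disjoint_left]
    intro s hs hs'
    obtain ⟨t, ht, rfl⟩ := mem_image.1 hs
    obtain ⟨t', ht', e⟩ := mem_image.1 hs'
    simp only [Prod.mk.injEq] at e
    have a1 := (hD t ht).1
    have a2 := (hD t' ht').1
    have a3 := (hD t' ht').2.1
    rw [← e.1, ← e.2.2] at a1
    exact absurd (a2.trans a3) a1.asymm
  have h3 := Finset.card_le_card (Finset.union_subset h1 h2)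
  rw [Finset.card_union_of_disjoint hdisj, Finset.card_image_of_injective,
    Finset.card_image_of_injective] at h3
  rotate_left
  · rintro ⟨a, b, c⟩ ⟨a', b', c'⟩ e; simp at e ⊢; tauto
  · rintro ⟨a, b, c⟩ ⟨a', b', c'⟩ e; simp at e ⊢; tauto
  have h4 := Finset.card_sdiff_add_card T' T
  have h5 := Finset.card_sdiff_add_card T T'
  rw [Finset.union_comm] at h5
  have h6 : (T' \ T).card = 0 := by omega
  have h7 : (T \ T').card = 0 := by omega
  rw [Finset.card_eq_zero, Finset.sdiff_eq_empty_iff_subset] at h6 h7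
  have hTT : T = T' := Finset.Subset.antisymm h7 h6
  ext v
  rw [← h.mem_crossingTriples (leftValues c), ← h.mem_crossingTriples (finalLeftValues w c),
    ← hT, ← hT', hTT]

/-- By `hB`, at time `k` only values below `highValue c k` stand left of the exchange. Unless row
`j` comes first, the values at the initial positions are below `highValue c j` and left of it; they
were already left of it just after letter `j`, when it stood at position `c j`. Counting them bounds
`c j` from below. -/
lemma IsReducedDecomposition.letter_order (h : IsReducedDecomposition w c)
    (hB : ∀ k, leftValues c k = finalLeftValues w c k) {j k : Fin N} (hjk : j < k) :
    highValue c j < highValue c k ∨ (highValue c j = highValue c k ∧ (c k : ℕ) < c j) ∨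
      (highValue c k < highValue c j ∧ (c k : ℕ) + 2 ≤ c j) := by
  have hleft : ∀ v, (pos c k v : ℕ) < c k → v < highValue c k := by
    intro v hv
    have : v ∈ leftValues c k := by
      simp only [leftValues, mem_filter, mem_univ, true_and, pos_lowValue, Fin.lt_def]
      exact hv
    rw [hB] at this
    simp only [finalLeftValues, mem_filter] at this
    exact this.2.1
  have hx : ∀ v, (pos c k v : ℕ) = c k → v = lowValue c k := by
    intro v hv
    apply pos_injective c k
    rw [pos_lowValue]
    exact Fin.ext hv
  have hy : ∀ v, (pos c k v : ℕ) = c k + 1 → v = highValue c k := by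
    intro v hv
    apply pos_injective c k
    rw [pos_highValue]
    exact Fin.ext hv
  have main : ∀ m : ℕ, m ≤ n + 1 →
      (∀ v, (pos c k v : ℕ) < m → v < highValue c j ∧ pos c k v < pos c k (highValue c j)) →
      m ≤ c j := by
    intro m hm hv
    rw [← card_pos_lt c k hm, ← card_pos_lt c (j + 1) (show (c j : ℕ) ≤ n + 1 by omega)]
    refine Finset.card_le_card fun v hv' => ?_
    simp only [mem_filter, mem_univ, true_and] at hv' ⊢
    have := h.not_inverted_anti (hv v hv').1 (show (j : ℕ) + 1 ≤ k from hjk) k.2.le (hv v hv').2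
    rw [pos_succ_highValue, Fin.lt_def] at this
    exact this
  have hlh := h.low_lt_high k
  have hck := (c k).2
  rcases lt_trichotomy (highValue c j) (highValue c k) with hlt | heq | hgt
  · exact Or.inl hlt
  · refine Or.inr (Or.inl ⟨heq, main (c k + 1) (by omega) fun v hv => ?_⟩)
    rw [heq, pos_highValue]
    refine ⟨?_, Fin.lt_def.2 (by simpa using hv)⟩
    rcases Nat.lt_succ_iff_lt_or_eq.1 hv with hv | hv
    · exact hleft v hv
    · rw [hx v hv]; exact hlh
  · refine Or.inr (Or.inr ⟨hgt, main (c k + 2) (by omega) fun v hv => ?_⟩)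
    -- The positions up to `c k + 1` hold values at most `highValue c k`, so the larger `highValue c
    -- j` lies beyond them.
    have hj : (c k : ℕ) + 2 ≤ pos c k (highValue c j) := by
      by_contra hc
      rcases lt_trichotomy (pos c k (highValue c j) : ℕ) (c k) with h1 | h1 | h1
      · exact absurd (hleft _ h1) hgt.asymm
      · have := hx _ h1
        rw [this] at hgt
        exact absurd hgt hlh.asymm
      · exact hgt.ne' (hy _ (by omega))
    refine ⟨?_, Fin.lt_def.2 (by omega)⟩
    rcases lt_trichotomy (pos c k v : ℕ) (c k) with h1 | h1 | h1
    · exact (hleft _ h1).trans hgt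
    · rw [hx _ h1]; exact hlh.trans hgt
    · rw [hy v (by omega)]; exact hgt

end Reduced

/-! ### The free cell of a letter -/

section Cells

variable {n N : ℕ} {w : Equiv.Perm (Fin (n + 1))} {c : Fin N → Fin n}

lemma IsReducedDecomposition.exists_column (h : IsReducedDecomposition w c) (k : Fin N) :
    ∃ q : Fin n, w q.castSucc ≤ highValue c k ∧ q.castSucc < w.symm (lowValue c k) ∧
      ∀ q', w q' ≤ highValue c k → q' < w.symm (lowValue c k) → q' ≤ q.castSucc := by
  have hne : (univ.filter fun q => w q ≤ highValue c k ∧ q < w.symm (lowValue c k)).Nonempty :=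
    ⟨w.symm (highValue c k), by simp [h.symm_high_lt_symm_low k]⟩
  have hm := Finset.max'_mem _ hne
  have hmax := Finset.le_max' (univ.filter fun q => w q ≤ highValue c k ∧ q < w.symm (lowValue c k))
  set q := Finset.max' _ hne
  simp only [mem_filter, mem_univ, true_and] at hm
  have hq : (q : ℕ) < n := by
    have := Fin.lt_def.1 hm.2
    have := (w.symm (lowValue c k)).2
    omega
  exact ⟨⟨q, hq⟩, hm.1, hm.2, fun q' h1 h2 => hmax q' (by simp [h1, h2])⟩

/-- By maximality of `q`, a value at most `highValue c k` lies in the columns up to `q` exactly when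
it precedes the low value in `w`. The summand 1 counts the high value itself. -/
lemma IsReducedDecomposition.rk_column (h : IsReducedDecomposition w c) {k : Fin N} {q : Fin n}
    (h3 : q.castSucc < w.symm (lowValue c k))
    (h4 : ∀ q', w q' ≤ highValue c k → q' < w.symm (lowValue c k) → q' ≤ q.castSucc) :
    rk w (highValue c k + 1) (q + 1) = (finalLeftValues w c k).card + 1 := by
  have hy : highValue c k ∉ finalLeftValues w c k := by simp [finalLeftValues]
  rw [← Finset.card_insert_of_notMem hy]
  unfold rk
  refine Finset.card_bij' (fun q _ => w q) (fun v _ => w.symm v) ?_ ?_ (by simp) (by simp)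
  · intro a ha
    simp only [mem_filter, mem_univ, true_and, finalLeftValues, mem_insert,
      Equiv.symm_apply_apply] at ha ⊢
    rcases eq_or_lt_of_le (show w a ≤ highValue c k from Fin.le_def.2 (by omega)) with e | e
    · exact Or.inl e
    · refine Or.inr ⟨e, lt_of_le_of_lt (Fin.le_def.2 ?_) h3⟩
      simp; omega
  · intro a ha
    simp only [mem_filter, mem_univ, true_and, finalLeftValues, mem_insert,
      Equiv.apply_symm_apply] at ha ⊢
    have : a ≤ highValue c k ∧ w.symm a < w.symm (lowValue c k) := by
      rcases ha with rfl | ha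
      · exact ⟨le_rfl, h.symm_high_lt_symm_low k⟩
      · exact ⟨ha.1.le, ha.2⟩
    have h5 := h4 (w.symm a) (by simpa using this.1) this.2
    have h6 := this.1
    rw [Fin.le_def] at h5 h6
    simp at h5
    omega

lemma rk_lt_rk {w : Equiv.Perm (Fin (n + 1))} {p q p' q' : ℕ} (hp : p ≤ p') (hq : q ≤ q')
    (k : Fin (n + 1)) (h1 : (k : ℕ) + 1 ≤ q') (h2 : (w k : ℕ) + 1 ≤ p')
    (h3 : ¬((k : ℕ) + 1 ≤ q ∧ (w k : ℕ) + 1 ≤ p)) : rk w p q < rk w p' q' := by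
  apply Finset.card_lt_card
  rw [Finset.ssubset_iff_of_subset]
  · refine ⟨k, mem_filter.2 ⟨mem_univ _, h1, h2⟩, fun h => h3 (mem_filter.1 h).2⟩
  · intro x hx
    simp only [mem_filter, mem_univ, true_and] at hx ⊢
    omega

lemma rk_full {w : Equiv.Perm (Fin (n + 1))} {p : ℕ} (hp : p ≤ n + 1) :
    rk w p (n + 1) = p := by
  have : rk w p (n + 1) = (univ.filter fun v : Fin (n + 1) => (v : ℕ) < p).card := by
    refine Finset.card_bij' (fun q _ => w q) (fun v _ => w.symm v) ?_ ?_ (by simp) (by simp)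
    · intro q hq; simp at hq ⊢; omega
    · intro q hq; simp at hq ⊢; omega
  rw [this, Fin.card_filter_val_lt]
  omega

lemma mem_freeCells {v : GridVertex n} : v ∈ freeCells w ↔
    rk w v.row v.col < v.row ∧ rk w (v.row - 1) v.col < rk w v.row v.col ∧
      rk w v.row (v.col - 1) < rk w v.row v.col := by
  simp [freeCells]

/-- The three strict inequalities are witnessed by the low value, which sits beyond column `q`, by
the high value, which is the value of the row, and by the entry of column `q`. -/
lemma IsReducedDecomposition.cell_mem_freeCells (h : IsReducedDecomposition w c) {k : Fin N}
    {q : Fin n} (h2 : w q.castSucc ≤ highValue c k)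
    (h3 : q.castSucc < w.symm (lowValue c k))
    (h4 : ∀ q', w q' ≤ highValue c k → q' < w.symm (lowValue c k) → q' ≤ q.castSucc) :
    ((highValue c k, q) : GridVertex n) ∈ freeCells w := by
  refine mem_freeCells.2 ?_
  change rk w (highValue c k + 1) (q + 1) < highValue c k + 1 ∧
    rk w (highValue c k + 1 - 1) (q + 1) < rk w (highValue c k + 1) (q + 1) ∧
    rk w (highValue c k + 1) (q + 1 - 1) < rk w (highValue c k + 1) (q + 1)
  have hlh := Fin.lt_def.1 (h.low_lt_high k)
  have h5 := h4 (w.symm (highValue c k)) (by simp) (h.symm_high_lt_symm_low k)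
  rw [Fin.le_def, Fin.val_castSucc] at h5
  rw [Fin.lt_def, Fin.val_castSucc] at h3
  rw [Fin.le_def] at h2
  have hv := q.2
  refine ⟨?_, ?_, ?_⟩
  · conv_rhs => rw [← rk_full (w := w) (p := highValue c k + 1) (by omega)]
    refine rk_lt_rk le_rfl (by omega) (w.symm (lowValue c k)) (by omega) ?_ ?_
    · rw [Equiv.apply_symm_apply]; omega
    · omega
  · refine rk_lt_rk (by omega) le_rfl (w.symm (highValue c k)) (by omega) ?_ ?_
    · rw [Equiv.apply_symm_apply]
    · rw [Equiv.apply_symm_apply]; omega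
  · refine rk_lt_rk le_rfl (by omega) q.castSucc (by simp) (by omega) ?_
    simp

/-- The letters of a geometrically compatible word correspond to the free cells; rows and letters
control the order of letters that do not commute. -/
theorem IsGeomCompatible.exists_equiv_freeCells (h : IsGeomCompatible w c) :
    ∃ φ : Fin N ≃ {v : GridVertex n // v ∈ freeCells w},
      (∀ k, rkVec w (φ k).1 = (c k).val + 1) ∧
      ∀ j k, j < k → (φ j).1.row < (φ k).1.row ∨
        ((φ j).1.row = (φ k).1.row ∧ (c k).val < (c j).val) ∨
        ((φ k).1.row < (φ j).1.row ∧ (c k).val + 2 ≤ (c j).val) := by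
  obtain ⟨hr, hm⟩ := h
  choose q h2 h3 h4 using hr.exists_column
  let ψ : Fin N → GridVertex n := fun k => (highValue c k, q k)
  have h1 : ∀ k, (ψ k).1 = highValue c k := fun _ => rfl
  have hψ : Function.Injective ψ := by
    -- If two letters shared a cell and the low value of `j` came earlier in `w`, it would be an
    -- admissible column for `k`, hence at most `q`, although it lies strictly beyond `q`.
    have key : ∀ j k, ψ j = ψ k → ¬ w.symm (lowValue c j) < w.symm (lowValue c k) := by
      intro j k e hlt
      have h5 := h4 k (w.symm (lowValue c j)) ?_ hlt
      · rw [← show q j = q k from congrArg Prod.snd e] at h5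
        exact absurd (h3 j) (not_lt.2 h5)
      · rw [← h1 k, ← e, h1 j]
        simpa using (hr.low_lt_high j).le
    intro j k e
    apply hr.pair_injective
    refine Prod.ext ?_ ?_
    · apply w.symm.injective
      exact le_antisymm (not_lt.1 (key k j e.symm)) (not_lt.1 (key j k e))
    · change highValue c j = highValue c k
      rw [← h1 k, ← e, h1 j]
  let f : Fin N → {v : GridVertex n // v ∈ freeCells w} := fun k =>
    ⟨ψ k, hr.cell_mem_freeCells (h2 k) (h3 k) (h4 k)⟩
  have hf : Function.Injective f := fun j k e => hψ (congrArg Subtype.val e)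
  have hcard : N = (freeCells w).card := by simpa using congrArg Multiset.card hm
  have hbij : Function.Bijective f := by
    rw [Fintype.bijective_iff_injective_and_card]
    exact ⟨hf, by simpa using hcard⟩
  let φ := Equiv.ofBijective f hbij
  have hrk : ∀ k, rkVec w (φ k).1 = (finalLeftValues w c k).card + 1 := fun k =>
    hr.rk_column (h3 k) (h4 k)
  -- Here the multiset equality is used only through its sum; equality of rank and letter for each
  -- `k` follows afterwards.
  have hsum : ∑ k, (leftValues c k).card = ∑ k, (finalLeftValues w c k).card := by
    have e1 : ∑ k, ((c k).val + 1) = ∑ v ∈ freeCells w, rkVec w v := by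
      exact congrArg Multiset.sum hm
    have e2 : ∑ v ∈ freeCells w, rkVec w v = ∑ k, ((finalLeftValues w c k).card + 1) := by
      rw [← Finset.sum_coe_sort, ← Equiv.sum_comp φ]
      exact Finset.sum_congr rfl fun k _ => hrk k
    rw [e2, Finset.sum_add_distrib, Finset.sum_add_distrib] at e1
    simp only [card_leftValues]
    omega
  have hB := hr.leftValues_eq hsum
  refine ⟨φ, fun k => ?_, fun j k hjk => ?_⟩
  · rw [hrk, ← hB, card_leftValues]
  · have hrow : ∀ k, (φ k).1.row = highValue c k + 1 := fun k => by
      simp only [GridVertex.row]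
      exact congrArg (fun x : Fin (n + 1) => (x : ℕ) + 1) (h1 k)
    rw [hrow, hrow]
    rcases hr.letter_order hB hjk with h | ⟨h, h'⟩ | ⟨h, h'⟩
    · exact Or.inl (by simpa using h)
    · exact Or.inr (Or.inl ⟨by rw [h], h'⟩)
    · exact Or.inr (Or.inr ⟨by simpa using h, h'⟩)

end Cells

/-! ### Maps given by polynomials in the Plücker coordinates -/

section Polynomials

variable {ι κ : Type} {d m : ι → ℕ} {d' m' : κ → ℕ}

lemma prod_weight_fst (t : PluckerVar d m →₀ ℕ) (a : ι → ℂ) :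
    (Finsupp.weight (fun v : PluckerVar d m => Finsupp.single v.1 1) t).prod (fun i k => a i ^ k) =
      t.prod fun v k => a v.1 ^ k := by
  have : Finsupp.weight (fun v : PluckerVar d m => Finsupp.single v.1 1) t =
      t.mapDomain Sigma.fst := by
    simp [Finsupp.weight_apply, Finsupp.mapDomain]
  rw [this, Finsupp.prod_mapDomain_index (by simp) (by intros; rw [pow_add])]

lemma sum_weight_fst {M : Type} [AddCommMonoid M] (t : PluckerVar d m →₀ ℕ) (a : ι → M) :
    (Finsupp.weight (fun v : PluckerVar d m => Finsupp.single v.1 1) t).sum (fun i k => k • a i) =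
      t.sum fun v k => k • a v.1 := by
  have : Finsupp.weight (fun v : PluckerVar d m => Finsupp.single v.1 1) t =
      t.mapDomain Sigma.fst := by
    simp [Finsupp.weight_apply, Finsupp.mapDomain]
  rw [this, Finsupp.sum_mapDomain_index (by simp) (by intros; rw [add_smul])]

lemma IsMultiHom.eval_mul {P : MvPolynomial (PluckerVar d m) ℂ} {e : ι →₀ ℕ} (hP : IsMultiHom P e)
    (a : ι → ℂ) (g : PluckerVar d m → ℂ) :
    MvPolynomial.eval (fun v => a v.1 * g v) P =
      e.prod (fun i k => a i ^ k) * MvPolynomial.eval g P := by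
  unfold IsMultiHom at hP
  induction hP using MvPolynomial.IsWeightedHomogeneous.induction_on with
  | zero => simp
  | add p q hp hq h1 h2 => simp only [map_add, h1, h2, mul_add]
  | monomial t r hr =>
    rw [← hr, prod_weight_fst, MvPolynomial.eval_monomial, MvPolynomial.eval_monomial]
    simp only [mul_pow, Finsupp.prod_mul]
    ring

lemma IsMultiHom.bind₁ {P : MvPolynomial (PluckerVar d' m') ℂ} {e : κ →₀ ℕ} (hP : IsMultiHom P e)
    {G : PluckerVar d' m' → MvPolynomial (PluckerVar d m) ℂ} {δ : κ → ι →₀ ℕ}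
    (hG : ∀ v, IsMultiHom (G v) (δ v.1)) :
    IsMultiHom (MvPolynomial.bind₁ G P) (e.sum fun j k => k • δ j) := by
  unfold IsMultiHom at hP
  induction hP using MvPolynomial.IsWeightedHomogeneous.induction_on with
  | zero => rw [map_zero]; exact MvPolynomial.isWeightedHomogeneous_zero _ _ _
  | add p q hp hq h1 h2 => rw [map_add]; exact MvPolynomial.IsWeightedHomogeneous.add h1 h2
  | monomial t r hr =>
    rw [← hr, sum_weight_fst, MvPolynomial.bind₁_monomial]
    refine MvPolynomial.IsWeightedHomogeneous.C_mul ?_ r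
    exact MvPolynomial.IsWeightedHomogeneous.prod _ _ _ fun v _ => (hG v).pow _

/-- Substituting `G` keeps a polynomial multihomogeneous, and the scalars `a` contribute a nonzero
factor depending only on the multidegree. It does not affect nonvanishing and cancels in quotients
of equal multidegree. -/
theorem isMorphism_of_coords {X : Set (ProdGr d m)} {Y : Set (ProdGr d' m')} {f : X → Y}
    {G : PluckerVar d' m' → MvPolynomial (PluckerVar d m) ℂ} {δ : κ → ι →₀ ℕ}
    (hG : ∀ v, IsMultiHom (G v) (δ v.1))
    (hf : ∀ x : X, ∃ a : κ → ℂ, (∀ j, a j ≠ 0) ∧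
      ∀ v, (f x).1.coords v = a v.1 * MvPolynomial.eval x.1.coords (G v)) :
    IsMorphism f := by
  choose a ha hf using hf
  have key : ∀ (x : X) {P : MvPolynomial (PluckerVar d' m') ℂ} {e : κ →₀ ℕ}, IsMultiHom P e →
      MvPolynomial.eval (f x).1.coords P = e.prod (fun j k => a x j ^ k) *
        MvPolynomial.eval x.1.coords (MvPolynomial.bind₁ G P) := by
    intro x P e hP
    rw [show (f x).1.coords = fun v => a x v.1 * MvPolynomial.eval x.1.coords (G v) from
      funext (hf x), hP.eval_mul]
    exact congrArg _ (MvPolynomial.eval₂Hom_bind₁ (RingHom.id ℂ) x.1.coords G P).symm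
  have hne : ∀ (x : X) (e : κ →₀ ℕ), e.prod (fun j k => a x j ^ k) ≠ 0 := fun x e =>
    Finset.prod_ne_zero_iff.2 fun j _ => pow_ne_zero _ (ha x j)
  have hcont : Continuous f := by
    refine continuous_induced_rng.2 (continuous_generateFrom_iff.2 ?_)
    rintro _ ⟨P, e, hP, rfl⟩
    have : (Subtype.val ∘ f) ⁻¹' {x | MvPolynomial.eval x.coords P ≠ 0} = Subtype.val ⁻¹'
        {x : ProdGr d m | MvPolynomial.eval x.coords (MvPolynomial.bind₁ G P) ≠ 0} := by
      ext x
      simp only [Set.mem_preimage, Function.comp_apply, Set.mem_ofPred_eq]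
      rw [key x hP, mul_ne_zero_iff]
      exact ⟨fun h => h.2, fun h => ⟨hne x e, h⟩⟩
    rw [this]
    have hopen : IsOpen {x : ProdGr d m |
        MvPolynomial.eval x.coords (MvPolynomial.bind₁ G P) ≠ 0} :=
      TopologicalSpace.isOpen_generateFrom_of_mem ⟨_, _, hP.bind₁ hG, rfl⟩
    exact hopen.preimage continuous_subtype_val
  refine ⟨hcont, fun U _ φ hφ x hx => ?_⟩
  obtain ⟨O, hO, hxO, hOU, P, Q, e, hP, hQ, h⟩ := hφ (f x) hx
  refine ⟨f ⁻¹' O, hO.preimage hcont, hxO, Set.preimage_mono hOU, _, _, _, hP.bind₁ hG,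
    hQ.bind₁ hG, fun y hy => ?_⟩
  obtain ⟨h1, h2⟩ := h (f y) hy
  rw [key y hQ] at h1 h2
  rw [key y hP, mul_div_mul_left _ _ (hne y e)] at h2
  exact ⟨(mul_ne_zero_iff.1 h1).2, h2⟩

/-- The Plücker coordinates of `g x` are, up to a common factor, multihomogeneous polynomials of a
common multidegree in those of `x`. -/
def IsPluckerPolynomial {X : Set (ProdGr d m)} {a b : ℕ} (g : X → Gr a b) : Prop :=
  ∃ (δ : ι →₀ ℕ) (G : (Fin a → Fin b) → MvPolynomial (PluckerVar d m) ℂ),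
    (∀ τ, IsMultiHom (G τ) δ) ∧ ∀ x : X, ∃ l : ℂ, l ≠ 0 ∧
      ∀ τ, (g x).plucker τ = l * MvPolynomial.eval x.1.coords (G τ)

theorem isMorphism_of_isPluckerPolynomial {X : Set (ProdGr d m)} {Y : Set (ProdGr d' m')}
    {f : X → Y} (hf : ∀ j, IsPluckerPolynomial fun x => (f x).1 j) : IsMorphism f := by
  choose δ G hG l hl h using hf
  exact isMorphism_of_coords (G := fun v => G v.1 v.2) (δ := δ) (fun v => hG v.1 v.2)
    fun x => ⟨fun j => l j x, fun j => hl j x, fun v => h v.1 x v.2⟩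

lemma isPluckerPolynomial_const {X : Set (ProdGr d m)} {a b : ℕ} {g : X → Gr a b}
    {W : Submodule ℂ (Fin b → ℂ)} (hg : ∀ x, (g x).1 = W) : IsPluckerPolynomial g := by
  -- A reference point supplies the constant coordinates; the empty case has none.
  rcases isEmpty_or_nonempty X with hX | ⟨⟨x₀⟩⟩
  · exact ⟨0, fun _ => 0, fun _ => MvPolynomial.isWeightedHomogeneous_zero _ _ _,
      fun x => hX.elim x⟩
  · refine ⟨0, fun τ => MvPolynomial.C ((g x₀).plucker τ),
      fun τ => MvPolynomial.isWeightedHomogeneous_C _ _, fun x => ⟨1, one_ne_zero, fun τ => ?_⟩⟩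
    rw [show g x = g x₀ from Subtype.ext ((hg x).trans (hg x₀).symm)]
    simp

end Polynomials

/-! ### Plücker coordinates of subspaces of a coordinate subspace -/

section Plucker

lemma Gr.plucker_eq_mul_det {d m : ℕ} (W : Gr d m) (B : Module.Basis (Fin d) ℂ W.1) :
    ∃ l : ℂ, l ≠ 0 ∧ ∀ σ : Fin d → Fin m,
      W.plucker σ = l * Matrix.det (Matrix.of fun a b => (B b : Fin m → ℂ) (σ a)) := by
  refine ⟨(B.toMatrix W.frame).det, ?_, fun σ => ?_⟩
  · rw [← Module.Basis.det_apply]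
    exact (B.isUnit_det W.frame).ne_zero
  · rw [mul_comm, ← Matrix.det_mul, Gr.plucker]
    congr 1
    ext a b
    have h := congrArg (fun v : W.1 => (v : Fin m → ℂ) (σ a)) (B.sum_toMatrix_smul_self W.frame b)
    simp only [Submodule.coe_sum, Submodule.coe_smul, Finset.sum_apply, Pi.smul_apply,
      smul_eq_mul] at h
    rw [Matrix.mul_apply, Matrix.of_apply, ← h]
    exact Finset.sum_congr rfl fun i _ => mul_comm _ _

lemma incl_apply_castLE {a b : ℕ} (h : a ≤ b) (v : Fin a → ℂ) (i : Fin a) :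
    incl h v (Fin.castLE h i) = v i :=
  (Fin.castLE_injective h).extend_apply _ _ _

lemma incl_apply_of_le {a b : ℕ} (h : a ≤ b) (v : Fin a → ℂ) (i : Fin b) (hi : a ≤ i) :
    incl h v i = 0 := by
  refine Function.extend_apply' _ _ _ ?_
  rintro ⟨j, rfl⟩
  have := j.2
  simp at hi
  omega

lemma incl_injective {a b : ℕ} (h : a ≤ b) : Function.Injective (incl h) := by
  intro v v' e
  ext i
  rw [← incl_apply_castLE h v, e, incl_apply_castLE]

lemma Gr.plucker_of_eq_map {d m m' : ℕ} (h : m ≤ m') (W : Gr d m) (W' : Gr d m')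
    (hW : W'.1 = W.1.map (incl h)) :
    ∃ l : ℂ, l ≠ 0 ∧ ∀ σ : Fin d → Fin m', W'.plucker σ =
      l * Matrix.det (Matrix.of fun a b => incl h (W.frame b : Fin m → ℂ) (σ a)) := by
  obtain ⟨l, hl, hσ⟩ := W'.plucker_eq_mul_det
    ((W.frame.map (Submodule.equivMapOfInjective _ (incl_injective h) W.1)).map
      (LinearEquiv.ofEq _ _ hW.symm))
  exact ⟨l, hl, fun σ => by simpa using hσ σ⟩

lemma Gr.exists_plucker_castLE {d m m' : ℕ} (h : m ≤ m') (W : Gr d m) (W' : Gr d m')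
    (hW : W'.1 = W.1.map (incl h)) :
    ∃ l : ℂ, l ≠ 0 ∧ (∀ σ : Fin d → Fin m,
        W'.plucker (fun i => Fin.castLE h (σ i)) = l * W.plucker σ) ∧
      ∀ (σ : Fin d → Fin m') (i : Fin d), m ≤ σ i → W'.plucker σ = 0 := by
  obtain ⟨l, hl, hσ⟩ := Gr.plucker_of_eq_map h W W' hW
  refine ⟨l, hl, fun σ => ?_, fun σ i hi => ?_⟩
  · rw [hσ]
    simp only [incl_apply_castLE]
    rfl
  · rw [hσ, Matrix.det_eq_zero_of_row_eq_zero i, mul_zero]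
    intro j
    exact incl_apply_of_le h _ _ hi

variable {ι : Type} {d m : ι → ℕ}

/-- The minors of the included subspace are the old minors, or zero as soon as one chosen row lies
outside the coordinate subspace. -/
lemma isPluckerPolynomial_incl {X : Set (ProdGr d m)} {a b : ℕ} {g : X → Gr a b} (i : ι)
    (ha : a = d i) (hb : m i ≤ b) (hg : ∀ x, (g x).1 = (x.1 i).1.map (incl hb)) :
    IsPluckerPolynomial g := by
  classical
  subst ha
  refine ⟨Finsupp.single i 1, fun τ => if hτ : ∀ s, (τ s : ℕ) < m i then
    MvPolynomial.X ⟨i, fun s => ⟨τ s, hτ s⟩⟩ else 0, fun τ => ?_, fun x => ?_⟩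
  · dsimp only
    split_ifs with hτ
    · exact MvPolynomial.isWeightedHomogeneous_X ℂ _ _
    · exact MvPolynomial.isWeightedHomogeneous_zero _ _ _
  · obtain ⟨l, hl, h1, h2⟩ := Gr.exists_plucker_castLE hb (x.1 i) (g x) (hg x)
    refine ⟨l, hl, fun τ => ?_⟩
    dsimp only
    split_ifs with hτ
    · rw [MvPolynomial.eval_X]
      exact h1 fun s => ⟨τ s, hτ s⟩
    · push Not at hτ
      obtain ⟨s, hs⟩ := hτ
      rw [map_zero, mul_zero, h2 τ s hs]

lemma isPluckerPolynomial_restrict {X : Set (ProdGr d m)} {a b : ℕ} {g : X → Gr a b} (i : ι)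
    (ha : a = d i) (hb : b ≤ m i) (hg : ∀ x, (g x).1.map (incl hb) = (x.1 i).1) :
    IsPluckerPolynomial g := by
  subst ha
  refine ⟨Finsupp.single i 1, fun τ => MvPolynomial.X ⟨i, fun s => Fin.castLE hb (τ s)⟩,
    fun τ => MvPolynomial.isWeightedHomogeneous_X ℂ _ _, fun x => ?_⟩
  obtain ⟨l, hl, h1, -⟩ := Gr.exists_plucker_castLE hb (g x) (x.1 i) (hg x).symm
  refine ⟨l⁻¹, inv_ne_zero hl, fun τ => ?_⟩
  rw [MvPolynomial.eval_X]
  change _ = l⁻¹ * (x.1 i).plucker _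
  rw [h1, inv_mul_cancel_left₀ hl]

end Plucker

/-! ### Sequences of entries with repeated labels -/

section LastVal

variable {N : ℕ} {α : Type*}

/-- The entry of `U` at the last position in `S` with label `i`, or `F i` if there is none. -/
def lastVal (l : Fin N → ℕ) (U : Fin N → α) (F : ℕ → α) (S : Finset (Fin N)) (i : ℕ) : α :=
  if h : (S.filter fun j => l j = i).Nonempty then U ((S.filter fun j => l j = i).max' h) else F i

variable {l y : Fin N → ℕ} {U : Fin N → α} {F : ℕ → α} {S T : Finset (Fin N)} {i : ℕ}

lemma lastVal_of_forall_ne (h : ∀ j ∈ S, l j ≠ i) : lastVal l U F S i = F i := by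
  unfold lastVal
  rw [dif_neg]
  rintro ⟨j, hj⟩
  rw [mem_filter] at hj
  exact h j hj.1 hj.2

lemma lastVal_of_isLast {k : Fin N} (hk : k ∈ S) (hi : l k = i)
    (h : ∀ j ∈ S, l j = i → j ≤ k) : lastVal l U F S i = U k := by
  have hmem : k ∈ S.filter fun j => l j = i := mem_filter.2 ⟨hk, hi⟩
  unfold lastVal
  rw [dif_pos ⟨k, hmem⟩]
  congr 1
  apply le_antisymm
  · apply Finset.max'_le
    intro j hj
    rw [mem_filter] at hj
    exact h j hj.1 hj.2
  · exact Finset.le_max' _ _ hmem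

lemma lastVal_congr (h : ∀ j, l j = i → (j ∈ S ↔ j ∈ T)) :
    lastVal l U F S i = lastVal l U F T i := by
  have : (S.filter fun j => l j = i) = T.filter fun j => l j = i := by
    ext j
    simp only [mem_filter]
    constructor
    · rintro ⟨h1, h2⟩; exact ⟨(h j h2).1 h1, h2⟩
    · rintro ⟨h1, h2⟩; exact ⟨(h j h2).2 h1, h2⟩
  unfold lastVal
  simp only [this]

/-- The alternative and the position `k` are independent of the entries, so one choice of
polynomials serves all points of the variety. -/
lemma lastVal_cases (l : Fin N → ℕ) (F : ℕ → α) (S : Finset (Fin N)) (i : ℕ) :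
    (∃ k ∈ S, l k = i ∧ (∀ U' : Fin N → α, lastVal l U' F S i = U' k)) ∨
      ∀ U' : Fin N → α, lastVal l U' F S i = F i := by
  by_cases h : (S.filter fun j => l j = i).Nonempty
  · have := mem_filter.1 ((S.filter fun j => l j = i).max'_mem h)
    exact Or.inl ⟨_, this.1, this.2, fun U' => dif_pos h⟩
  · exact Or.inr fun U' => dif_neg h

/-- The first `k` positions. -/
def initial (N k : ℕ) : Finset (Fin N) := univ.filter fun j => (j : ℕ) < k

/-- The positions whose row is at most `p`. -/
def upToRow (y : Fin N → ℕ) (p : ℕ) : Finset (Fin N) := univ.filter fun j => y j ≤ p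

/-- The positions whose row is less than `p`, and those in row `p` with label at least `m`. -/
def upToLabel (l y : Fin N → ℕ) (p m : ℕ) : Finset (Fin N) :=
  univ.filter fun j => y j < p ∨ (y j = p ∧ m ≤ l j)

@[simp] lemma mem_initial {k : ℕ} {j : Fin N} : j ∈ initial N k ↔ (j : ℕ) < k := by simp [initial]

@[simp] lemma mem_upToRow {p : ℕ} {j : Fin N} : j ∈ upToRow y p ↔ y j ≤ p := by simp [upToRow]

@[simp] lemma mem_upToLabel {p m : ℕ} {j : Fin N} :
    j ∈ upToLabel l y p m ↔ y j < p ∨ (y j = p ∧ m ≤ l j) := by simp [upToLabel]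

/-- Positions with equal or consecutive labels are ordered by increasing row, and by decreasing
label within a row. -/
def LabelOrder (l y : Fin N → ℕ) : Prop :=
  ∀ j k, j < k → y j < y k ∨ (y j = y k ∧ l k < l j) ∨ (y k < y j ∧ l k + 2 ≤ l j)

/-- The third alternative in `LabelOrder` needs labels at least two apart, so here the order is
lexicographic in row and decreasing label. -/
lemma LabelOrder.le_iff (H : LabelOrder l y) {j k : Fin N} (h1 : l j ≤ l k + 1)
    (h2 : l k ≤ l j + 1) : k ≤ j ↔ y k < y j ∨ (y k = y j ∧ l j ≤ l k) := by
  rcases lt_trichotomy j k with h | rfl | h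
  · have := H j k h
    constructor
    · intro h'; exact absurd h (not_lt.2 h')
    · omega
  · simp
  · have := H k j h
    constructor
    · omega
    · intro _; exact h.le

variable [Preorder α]

/-- On positions labelled `i` or `i + 1`, `upToLabel` is closed downwards for the lexicographic
order, hence agrees with the initial segment ending at its last such position. -/
lemma LabelOrder.lastVal_upToLabel_le (H : LabelOrder l y) (hF : ∀ i, F i ≤ F (i + 1))
    (h : ∀ k ≤ N, ∀ i, lastVal l U F (initial N k) i ≤ lastVal l U F (initial N k) (i + 1))
    (p m i : ℕ) :
    lastVal l U F (upToLabel l y p m) i ≤ lastVal l U F (upToLabel l y p m) (i + 1) := by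
  by_cases hA : ((upToLabel l y p m).filter fun j => l j = i ∨ l j = i + 1).Nonempty
  · have hm := Finset.max'_mem _ hA
    have hmax := Finset.le_max' ((upToLabel l y p m).filter fun j => l j = i ∨ l j = i + 1)
    set j := Finset.max' _ hA
    simp only [mem_filter, mem_upToLabel] at hm hmax
    have key : ∀ k, l k = i ∨ l k = i + 1 → (k ∈ upToLabel l y p m ↔ k ∈ initial N (j + 1)) := by
      intro k hk
      rw [mem_upToLabel, mem_initial]
      constructor
      · intro hk'
        exact Nat.lt_succ_of_le (Fin.le_def.1 (hmax k ⟨hk', hk⟩))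
      · intro hk'
        have := (H.le_iff (j := j) (k := k) (by omega) (by omega)).1
          (Fin.le_def.2 (Nat.le_of_lt_succ hk'))
        omega
    rw [lastVal_congr fun k hk => key k (Or.inl hk), lastVal_congr fun k hk => key k (Or.inr hk)]
    exact h _ j.2 i
  · have : ∀ k ∈ upToLabel l y p m, l k ≠ i ∧ l k ≠ i + 1 := by
      intro k hk
      by_contra hc
      exact hA ⟨k, mem_filter.2 ⟨hk, by omega⟩⟩
    rw [lastVal_of_forall_ne fun k hk => (this k hk).1,
      lastVal_of_forall_ne fun k hk => (this k hk).2]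
    exact hF i

/-- The converse passage: the last position `j` labelled `i` or `i + 1` determines the lexicographic
cut, so only cuts located at a letter have to be checked. -/
lemma LabelOrder.lastVal_initial_le (H : LabelOrder l y) (hF : ∀ i, F i ≤ F (i + 1))
    (h : ∀ j i, i = l j ∨ i + 1 = l j → lastVal l U F (upToLabel l y (y j) (l j)) i ≤
      lastVal l U F (upToLabel l y (y j) (l j)) (i + 1)) (k i : ℕ) :
    lastVal l U F (initial N k) i ≤ lastVal l U F (initial N k) (i + 1) := by
  by_cases hA : ((initial N k).filter fun j => l j = i ∨ l j = i + 1).Nonempty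
  · have hm := Finset.max'_mem _ hA
    have hmax := Finset.le_max' ((initial N k).filter fun j => l j = i ∨ l j = i + 1)
    set j := Finset.max' _ hA
    simp only [mem_filter, mem_initial] at hm hmax
    have key : ∀ k', l k' = i ∨ l k' = i + 1 →
        (k' ∈ initial N k ↔ k' ∈ upToLabel l y (y j) (l j)) := by
      intro k' hk
      rw [mem_upToLabel, mem_initial, ← H.le_iff (by omega) (by omega)]
      constructor
      · intro hk'
        exact hmax k' ⟨hk', hk⟩
      · intro hk'
        exact lt_of_le_of_lt (Fin.le_def.1 hk') hm.1
    rw [lastVal_congr fun k hk => key k (Or.inl hk), lastVal_congr fun k hk => key k (Or.inr hk)]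
    exact h j i (by omega)
  · have : ∀ k' ∈ initial N k, l k' ≠ i ∧ l k' ≠ i + 1 := by
      intro k hk
      by_contra hc
      exact hA ⟨k, mem_filter.2 ⟨hk, by omega⟩⟩
    rw [lastVal_of_forall_ne fun k hk => (this k hk).1,
      lastVal_of_forall_ne fun k hk => (this k hk).2]
    exact hF i

end LastVal

/-! ### Rank functions of permutations -/

section Rank

variable {n : ℕ} {w : Equiv.Perm (Fin (n + 1))}

lemma rk_mono {p q p' q' : ℕ} (hp : p ≤ p') (hq : q ≤ q') : rk w p q ≤ rk w p' q' := by
  refine Finset.card_le_card fun k hk => ?_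
  simp only [mem_filter, mem_univ, true_and] at hk ⊢
  omega

lemma rk_zero_left (q : ℕ) : rk w 0 q = 0 := by simp [rk]

lemma rk_zero_right (p : ℕ) : rk w p 0 = 0 := by simp [rk]

lemma rk_le_row {p : ℕ} (q : ℕ) (hp : p ≤ n + 1) : rk w p q ≤ p := by
  rcases le_total q (n + 1) with h | h
  · exact (rk_mono le_rfl h).trans_eq (rk_full hp)
  · conv_rhs => rw [← rk_full (w := w) hp]
    refine Finset.card_le_card fun k hk => ?_
    simp only [mem_filter, mem_univ, true_and] at hk ⊢
    omega

lemma rk_succ_col_le (p q : ℕ) : rk w p (q + 1) ≤ rk w p q + 1 := by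
  by_cases hq : q < n + 1
  · refine (Finset.card_le_card (t := insert ⟨q, hq⟩ (univ.filter fun k : Fin (n + 1) =>
      k.val + 1 ≤ q ∧ (w k).val + 1 ≤ p)) fun k hk => ?_).trans (Finset.card_insert_le _ _)
    simp only [mem_filter, mem_univ, true_and, mem_insert, Fin.ext_iff] at hk ⊢
    omega
  · refine (Finset.card_le_card fun k hk => ?_).trans (Nat.le_succ _)
    simp only [mem_filter, mem_univ, true_and] at hk ⊢
    omega

lemma rk_succ_row_le (p q : ℕ) : rk w (p + 1) q ≤ rk w p q + 1 := by
  by_cases hp : p < n + 1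
  · refine (Finset.card_le_card (t := insert (w.symm ⟨p, hp⟩) (univ.filter fun k : Fin (n + 1) =>
      k.val + 1 ≤ q ∧ (w k).val + 1 ≤ p)) fun k hk => ?_).trans (Finset.card_insert_le _ _)
    simp only [mem_filter, mem_univ, true_and, mem_insert, Equiv.eq_symm_apply,
      Fin.ext_iff] at hk ⊢
    omega
  · refine (Finset.card_le_card fun k hk => ?_).trans (Nat.le_succ _)
    have := (w k).2
    simp only [mem_filter, mem_univ, true_and] at hk ⊢
    omega

lemma rk_last_row {q : ℕ} (hq : q ≤ n + 1) : rk w (n + 1) q = q := by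
  have : rk w (n + 1) q = (univ.filter fun k : Fin (n + 1) => (k : ℕ) < q).card := by
    unfold rk
    congr 1
    ext k
    simp only [mem_filter, mem_univ, true_and]
    omega
  rw [this, Fin.card_filter_val_lt]
  omega

lemma exists_rk_eq {p i : ℕ} (hp : p ≤ n + 1) (hi : i < p) : ∃ q ≤ n, rk w p q = i := by
  classical
  have hex : ∃ q, i < rk w p q := ⟨n + 1, by rwa [rk_full hp]⟩
  have h1 := Nat.find_spec hex
  have h2 : Nat.find hex ≤ n + 1 := Nat.find_min' hex (by rwa [rk_full hp])
  cases hq : Nat.find hex with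
  | zero => rw [hq, rk_zero_right] at h1; omega
  | succ q =>
    have h3 := Nat.find_min hex (m := q) (by omega)
    rw [hq] at h1 h2
    have := rk_succ_col_le (w := w) p q
    exact ⟨q, by omega, by omega⟩

lemma rk_eq_of_rk_eq {p p' q q' : ℕ} (hp : p' ≤ p) (hq : q' ≤ q) (h : rk w p q = rk w p' q) :
    rk w p q' = rk w p' q' := by
  have hsub : (univ.filter fun k : Fin (n + 1) => k.val + 1 ≤ q ∧ (w k).val + 1 ≤ p') ⊆
      univ.filter fun k : Fin (n + 1) => k.val + 1 ≤ q ∧ (w k).val + 1 ≤ p := by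
    intro k hk
    simp only [mem_filter, mem_univ, true_and] at hk ⊢
    omega
  have heq := Finset.eq_of_subset_of_card_le hsub h.le
  refine le_antisymm (Finset.card_le_card fun k hk => ?_) (rk_mono hp le_rfl)
  have h1 : k ∈ univ.filter fun k : Fin (n + 1) => k.val + 1 ≤ q ∧ (w k).val + 1 ≤ p := by
    simp only [mem_filter, mem_univ, true_and] at hk ⊢
    omega
  rw [← heq] at h1
  simp only [mem_filter, mem_univ, true_and] at hk h1 ⊢
  omega

/-- Up to column `q` the rows `p` and `p + 1` have equal ranks, so no cell there is free in row `p +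
1`. Beyond `q`, a free cell has rank strictly above that of the column before it, hence above the
rank at `q`. -/
lemma rkVec_ne_of_mem_freeCells {v : GridVertex n} (hv : v ∈ freeCells w) {p q : ℕ}
    (hp : v.row = p + 1) (h : rk w (p + 1) q = rk w p q) : rkVec w v ≠ rk w (p + 1) q := by
  obtain ⟨-, h1, h2⟩ := mem_freeCells.1 hv
  unfold rkVec
  rw [hp, Nat.add_sub_cancel] at h1
  rw [hp] at h2 ⊢
  intro e
  rcases le_or_gt v.col q with hq | hq
  · have : rk w (p + 1) v.col = rk w p v.col := rk_eq_of_rk_eq (Nat.le_succ p) hq h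
    omega
  · have := rk_mono (w := w) (le_refl (p + 1)) (show q ≤ v.col - 1 by omega)
    omega

end Rank

/-! ### Subspaces of coordinate subspaces -/

section Subspaces

variable {n : ℕ}

lemma incl_incl {a b d : ℕ} (h : a ≤ b) (h' : b ≤ d) (x : Fin a → ℂ) :
    incl h' (incl h x) = incl (h.trans h') x := by
  ext i
  by_cases hb : (i : ℕ) < b
  · obtain ⟨j, rfl⟩ : ∃ j, i = Fin.castLE h' j := ⟨⟨i, hb⟩, rfl⟩
    rw [incl_apply_castLE]
    by_cases ha : (j : ℕ) < a
    · obtain ⟨k, rfl⟩ : ∃ k, j = Fin.castLE h k := ⟨⟨j, ha⟩, rfl⟩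
      rw [incl_apply_castLE]
      exact (incl_apply_castLE (h.trans h') x k).symm
    · rw [incl_apply_of_le _ _ _ (not_lt.1 ha), incl_apply_of_le _ _ _ (by simpa using ha)]
  · rw [incl_apply_of_le _ _ _ (not_lt.1 hb), incl_apply_of_le _ _ _ (by omega)]

lemma incl_incl_mem {a b d : ℕ} (h : a ≤ b) (h' : b ≤ d) {x : Fin a → ℂ}
    {W : Submodule ℂ (Fin d → ℂ)} (hx : incl (h.trans h') x ∈ W) : incl h' (incl h x) ∈ W := by
  rwa [incl_incl]

lemma incl_refl (a : ℕ) : incl (le_refl a) = LinearMap.id := by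
  ext x i
  exact incl_apply_castLE (le_refl a) _ i

lemma incl_single {a b : ℕ} (h : a ≤ b) (i : Fin a) :
    incl h (Pi.single i 1) = Pi.single (Fin.castLE h i) 1 := by
  ext j
  by_cases hj : (j : ℕ) < a
  · obtain ⟨k, rfl⟩ : ∃ k, j = Fin.castLE h k := ⟨⟨j, hj⟩, rfl⟩
    rw [incl_apply_castLE]
    simp [Pi.single_apply]
  · rw [incl_apply_of_le _ _ _ (not_lt.1 hj), Pi.single_apply, if_neg]
    rintro rfl
    exact hj i.2

lemma stdSubspace_eq_range {p : ℕ} (hp : p ≤ n + 1) :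
    stdSubspace n p = LinearMap.range (incl hp) := by
  rw [LinearMap.range_eq_map, ← (Pi.basisFun ℂ (Fin p)).span_eq, Submodule.map_span, stdSubspace]
  congr 1
  ext v
  constructor
  · rintro ⟨t, ht, rfl⟩
    exact ⟨_, ⟨⟨t, ht⟩, rfl⟩, by rw [Pi.basisFun_apply, incl_single]; rfl⟩
  · rintro ⟨_, ⟨i, rfl⟩, rfl⟩
    exact ⟨Fin.castLE hp i, i.2, by rw [Pi.basisFun_apply, incl_single]⟩

lemma stdSubspace_mono {p q : ℕ} (h : p ≤ q) : stdSubspace n p ≤ stdSubspace n q :=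
  Submodule.span_mono fun _ ⟨t, ht, hv⟩ => ⟨t, by omega, hv⟩

lemma stdSubspace_zero : stdSubspace n 0 = ⊥ := by simp [stdSubspace]

lemma stdSubspace_eq_top {p : ℕ} (h : n + 1 ≤ p) : stdSubspace n p = ⊤ := by
  refine top_le_iff.1 (le_trans ?_ (stdSubspace_mono h))
  rw [stdSubspace_eq_range le_rfl, incl_refl, LinearMap.range_id]

lemma finrank_stdSubspace {p : ℕ} (hp : p ≤ n + 1) :
    Module.finrank ℂ (stdSubspace n p) = p := by
  rw [stdSubspace_eq_range hp, LinearMap.finrank_range_of_inj (incl_injective hp)]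
  simp

lemma finrank_map_incl {a b : ℕ} (h : a ≤ b) (W : Submodule ℂ (Fin a → ℂ)) :
    Module.finrank ℂ (W.map (incl h)) = Module.finrank ℂ W :=
  (Submodule.equivMapOfInjective _ (incl_injective h) W).finrank_eq.symm

variable {e : GridVertex n → ℕ}

lemma comp_le_stdSubspace (R : ProdGr e (gridRep n).dim) (v : GridVertex n) :
    comp R v ≤ stdSubspace n v.row := by
  rw [stdSubspace_eq_range (show v.row ≤ n + 1 from v.1.isLt)]
  exact LinearMap.map_le_range

lemma finrank_comp (R : ProdGr e (gridRep n).dim) (v : GridVertex n) :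
    Module.finrank ℂ (comp R v) = e v :=
  (finrank_map_incl (a := v.row) v.1.isLt (R v).1).trans (R v).2

lemma comp_down {R : ProdGr e (gridRep n).dim} (hR : R ∈ quiverGrassmannian (gridRep n) e)
    (i i' : Fin (n + 1)) (j : Fin n) (h : i'.val = i.val + 1) :
    comp R (i, j) ≤ comp R (i', j) := by
  have := hR (i, j) (i', j) (GridArrow.down i i' j h)
  rintro _ ⟨x, hx, rfl⟩
  exact ⟨_, this ⟨x, hx, rfl⟩, incl_incl (a := i.val + 1) (b := i'.val + 1) _ i'.isLt x⟩

lemma comp_right {R : ProdGr e (gridRep n).dim} (hR : R ∈ quiverGrassmannian (gridRep n) e)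
    (i : Fin (n + 1)) (j j' : Fin n) (h : j'.val = j.val + 1) :
    comp R (i, j) ≤ comp R (i, j') := by
  have := hR (i, j) (i, j') (GridArrow.right i j j' h)
  rintro _ ⟨x, hx, rfl⟩
  exact ⟨_, this ⟨x, hx, rfl⟩, rfl⟩

lemma comp_mono {R : ProdGr e (gridRep n).dim} (hR : R ∈ quiverGrassmannian (gridRep n) e)
    {v v' : GridVertex n} (hrow : v.row ≤ v'.row) (hcol : v.col ≤ v'.col) :
    comp R v ≤ comp R v' := by
  obtain ⟨⟨i, hi⟩, ⟨j, hj⟩⟩ := v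
  obtain ⟨⟨i', hi'⟩, ⟨j', hj'⟩⟩ := v'
  simp only [GridVertex.row, GridVertex.col, add_le_add_iff_right] at hrow hcol
  have h1 : comp R (⟨i, hi⟩, ⟨j, hj⟩) ≤ comp R (⟨i', hi'⟩, ⟨j, hj⟩) := by
    induction i', hrow using Nat.le_induction with
    | base => exact le_rfl
    | succ m hm ih => exact (ih (by omega)).trans (comp_down hR _ _ _ rfl)
  have h2 : comp R (⟨i', hi'⟩, ⟨j, hj⟩) ≤ comp R (⟨i', hi'⟩, ⟨j', hj'⟩) := by
    induction j', hcol using Nat.le_induction with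
    | base => exact le_rfl
    | succ m hm ih => exact (ih (by omega)).trans (comp_right hR _ _ _ rfl)
  exact h1.trans h2

lemma exists_vertex {p q : ℕ} (hp : 1 ≤ p) (hp' : p ≤ n + 1) (hq : 1 ≤ q) (hq' : q ≤ n) :
    ∃ v : GridVertex n, v.row = p ∧ v.col = q :=
  ⟨(⟨p - 1, by omega⟩, ⟨q - 1, by omega⟩), by simp [GridVertex.row]; omega,
    by simp [GridVertex.col]; omega⟩

end Subspaces

/-! ### Bott–Samelson varieties as quiver Grassmannians -/

section Iso

variable {n N : ℕ} {w : Equiv.Perm (Fin (n + 1))} {c : Fin N → Fin n}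
  {φ : Fin N → {v : GridVertex n // v ∈ freeCells w}}

/-- The letters of a word, starting from `1`. -/
def label (c : Fin N → Fin n) (k : Fin N) : ℕ := (c k).val + 1

/-- The row of the cell attached to a letter. -/
def cellRow (φ : Fin N → {v : GridVertex n // v ∈ freeCells w}) (k : Fin N) : ℕ := (φ k).1.row

/-- The cell of each letter has the letter as its rank, and the rows of the cells are compatible
with the order of the letters. -/
structure IsCellLabelling (c : Fin N → Fin n)
    (φ : Fin N → {v : GridVertex n // v ∈ freeCells w}) : Prop where
  rk_eq : ∀ k, rkVec w (φ k).1 = label c k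
  order : LabelOrder (label c) (cellRow φ)

/-- The subspace of dimension `i` that is current after the letters in `S`, where the `k`-th letter
installs the subspace `U k` and the process starts with the standard flag. -/
def currentSubspace (c : Fin N → Fin n) (U : Fin N → Submodule ℂ (Fin (n + 1) → ℂ))
    (S : Finset (Fin N)) (i : ℕ) : Submodule ℂ (Fin (n + 1) → ℂ) :=
  lastVal (label c) U (stdSubspace n) S i

variable {U : Fin N → Submodule ℂ (Fin (n + 1) → ℂ)}

lemma label_le (c : Fin N → Fin n) (k : Fin N) : label c k ≤ n := (c k).2

lemma row_le (v : GridVertex n) : v.row ≤ n + 1 := v.1.2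

lemma col_le (v : GridVertex n) : v.col ≤ n := v.2.2

lemma rkVec_le_row (w : Equiv.Perm (Fin (n + 1))) (v : GridVertex n) : rkVec w v ≤ v.row :=
  rk_le_row _ (row_le v)

lemma IsCellLabelling.label_lt (h : IsCellLabelling c φ) (k : Fin N) :
    label c k < cellRow φ k := by
  rw [← h.rk_eq]
  exact (mem_freeCells.1 (φ k).2).1

lemma currentSubspace_zero (c : Fin N → Fin n) (U : Fin N → Submodule ℂ (Fin (n + 1) → ℂ))
    (S : Finset (Fin N)) : currentSubspace c U S 0 = ⊥ :=
  (lastVal_of_forall_ne fun _ _ => Nat.succ_ne_zero _).trans stdSubspace_zero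

lemma currentSubspace_of_lt (U : Fin N → Submodule ℂ (Fin (n + 1) → ℂ)) (S : Finset (Fin N))
    {i : ℕ} (hi : n < i) : currentSubspace c U S i = stdSubspace n i :=
  lastVal_of_forall_ne fun j _ => ((label_le c j).trans_lt hi).ne

/-- A label is smaller than its row, so letters in rows up to `p` never touch dimensions `p` and
higher. -/
lemma IsCellLabelling.currentSubspace_upToRow (h : IsCellLabelling c φ)
    (U : Fin N → Submodule ℂ (Fin (n + 1) → ℂ)) {p i : ℕ} (hi : p ≤ i) :
    currentSubspace c U (upToRow (cellRow φ) p) i = stdSubspace n i := by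
  refine lastVal_of_forall_ne fun j hj => ?_
  have := h.label_lt j
  rw [mem_upToRow] at hj
  omega

lemma finrank_currentSubspace (hU : ∀ k, Module.finrank ℂ (U k) = label c k) (S : Finset (Fin N))
    {i : ℕ} (hi : i ≤ n + 1) : Module.finrank ℂ (currentSubspace c U S i) = i := by
  rcases lastVal_cases (label c) (stdSubspace n) S i with ⟨k, -, hk, h⟩ | h
  · rw [currentSubspace, h, hU, hk]
  · rw [currentSubspace, h, finrank_stdSubspace hi]

lemma currentSubspace_congr {S T : Finset (Fin N)} {i : ℕ}
    (h : ∀ j, label c j = i → (j ∈ S ↔ j ∈ T)) :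
    currentSubspace c U S i = currentSubspace c U T i := lastVal_congr h

lemma currentSubspace_upToLabel_zero (y : Fin N → ℕ) (p i : ℕ) :
    currentSubspace c U (upToLabel (label c) y p 0) i = currentSubspace c U (upToRow y p) i :=
  currentSubspace_congr fun j _ => by rw [mem_upToLabel, mem_upToRow]; omega

lemma currentSubspace_upToLabel_of_le (y : Fin N → ℕ) {p m i : ℕ} (hi : m ≤ i) :
    currentSubspace c U (upToLabel (label c) y p m) i = currentSubspace c U (upToRow y p) i :=
  currentSubspace_congr fun j _ => by rw [mem_upToLabel, mem_upToRow]; omega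

lemma currentSubspace_upToLabel_of_gt (y : Fin N → ℕ) {p m i : ℕ} (hi : i < m) :
    currentSubspace c U (upToLabel (label c) y (p + 1) m) i = currentSubspace c U (upToRow y p) i :=
  currentSubspace_congr fun j _ => by rw [mem_upToLabel, mem_upToRow]; omega

lemma IsCellLabelling.currentSubspace_cell (h : IsCellLabelling c φ)
    (U : Fin N → Submodule ℂ (Fin (n + 1) → ℂ)) (k : Fin N) :
    currentSubspace c U (upToRow (cellRow φ) (cellRow φ k)) (label c k) = U k := by
  refine lastVal_of_isLast (by simp) rfl fun j hj hjk => ?_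
  rw [mem_upToRow] at hj
  exact (h.order.le_iff (by omega) (by omega)).2 (by omega)

lemma currentSubspace_initial_self (c : Fin N → Fin n)
    (U : Fin N → Submodule ℂ (Fin (n + 1) → ℂ)) (k : Fin N) :
    currentSubspace c U (initial N (k + 1)) (label c k) = U k := by
  refine lastVal_of_isLast (by simp) rfl fun j hj _ => ?_
  rw [mem_initial] at hj
  exact Fin.le_def.2 (Nat.le_of_lt_succ hj)

lemma IsCellLabelling.currentSubspace_row_eq (h : IsCellLabelling c φ)
    (U : Fin N → Submodule ℂ (Fin (n + 1) → ℂ)) {p q : ℕ} (hr : rk w (p + 1) q = rk w p q) :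
    currentSubspace c U (upToRow (cellRow φ) (p + 1)) (rk w (p + 1) q) =
      currentSubspace c U (upToRow (cellRow φ) p) (rk w (p + 1) q) := by
  refine currentSubspace_congr fun j hj => ?_
  rw [mem_upToRow, mem_upToRow]
  have : cellRow φ j ≠ p + 1 := by
    intro hp
    apply rkVec_ne_of_mem_freeCells (φ j).2 hp hr
    rw [h.rk_eq, hj]
  omega

/-! #### From flags to representations -/

/-- The subspaces that the letters install in a sequence of flags. -/
def bottSamelsonEntries (V : bottSamelson c) (k : Fin N) : Submodule ℂ (Fin (n + 1) → ℂ) :=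
  (V.1 (k.succ, c k)).1

lemma finrank_bottSamelsonEntries (V : bottSamelson c) (k : Fin N) :
    Module.finrank ℂ (bottSamelsonEntries V k) = label c k := (V.1 (k.succ, c k)).2

lemma bottSamelson_eq_currentSubspace (V : bottSamelson c) (k : Fin (N + 1)) (i : Fin n) :
    (V.1 (k, i)).1 = currentSubspace c (bottSamelsonEntries V) (initial N k) (i + 1) := by
  induction k using Fin.induction with
  | zero =>
    rw [V.2.2.1 i]
    exact (lastVal_of_forall_ne fun j hj => by simp at hj).symm
  | succ k ih =>
    by_cases hi : i = c k
    · subst hi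
      exact (currentSubspace_initial_self c (bottSamelsonEntries V) k).symm
    · rw [← V.2.2.2 k i hi, ih]
      refine currentSubspace_congr fun j hj => ?_
      rw [mem_initial, mem_initial, Fin.val_castSucc, Fin.val_succ]
      have : j ≠ k := by
        rintro rfl
        exact hi (Fin.ext (Nat.succ_injective hj.symm))
      rw [Ne, Fin.ext_iff] at this
      omega

lemma currentSubspace_bottSamelson_le (V : bottSamelson c) {k : ℕ} (hk : k ≤ N) (i : ℕ) :
    currentSubspace c (bottSamelsonEntries V) (initial N k) i ≤
      currentSubspace c (bottSamelsonEntries V) (initial N k) (i + 1) := by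
  rcases Nat.eq_zero_or_pos i with rfl | hi
  · rw [currentSubspace_zero]; exact bot_le
  · rcases Nat.lt_or_ge i n with hin | hin
    · have h1 := bottSamelson_eq_currentSubspace V ⟨k, by omega⟩ ⟨i - 1, by omega⟩
      have h2 := bottSamelson_eq_currentSubspace V ⟨k, by omega⟩ ⟨i, hin⟩
      simp only [Nat.sub_add_cancel hi] at h1 h2
      rw [← h1, ← h2]
      exact V.2.1 _ _ _ (Fin.le_def.2 (Nat.sub_le _ _))
    · rw [currentSubspace_of_lt _ _ (show n < i + 1 by omega), stdSubspace_eq_top (by omega)]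
      exact le_top

lemma IsCellLabelling.currentSubspace_upToLabel_le (h : IsCellLabelling c φ) (V : bottSamelson c)
    (p m i : ℕ) :
    currentSubspace c (bottSamelsonEntries V) (upToLabel (label c) (cellRow φ) p m) i ≤
      currentSubspace c (bottSamelsonEntries V) (upToLabel (label c) (cellRow φ) p m) (i + 1) :=
  h.order.lastVal_upToLabel_le (fun i => stdSubspace_mono (Nat.le_succ i))
    (fun _ hk i => currentSubspace_bottSamelson_le V hk i) p m i

lemma IsCellLabelling.monotone_currentSubspace_upToRow (h : IsCellLabelling c φ)
    (V : bottSamelson c) (p : ℕ) :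
    Monotone (currentSubspace c (bottSamelsonEntries V) (upToRow (cellRow φ) p)) := by
  refine monotone_nat_of_le_succ fun i => ?_
  have := h.currentSubspace_upToLabel_le V p 0 i
  rwa [currentSubspace_upToLabel_zero, currentSubspace_upToLabel_zero] at this

/-- If the rank is unchanged, row `p + 1` installs nothing in that dimension. If it grows by one,
the cut inside row `p + 1` at the new rank shows the old row in the smaller dimension and the new
row in the larger. -/
lemma IsCellLabelling.currentSubspace_row_le (h : IsCellLabelling c φ) (V : bottSamelson c)
    (p q : ℕ) :
    currentSubspace c (bottSamelsonEntries V) (upToRow (cellRow φ) p) (rk w p q) ≤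
      currentSubspace c (bottSamelsonEntries V) (upToRow (cellRow φ) (p + 1))
        (rk w (p + 1) q) := by
  have h1 := rk_mono (w := w) (Nat.le_succ p) (le_refl q)
  have h2 := rk_succ_row_le (w := w) p q
  rcases Nat.eq_or_lt_of_le h1 with h3 | h3
  · rw [h.currentSubspace_row_eq _ h3.symm, h3]
  · have h4 : rk w (p + 1) q = rk w p q + 1 := le_antisymm h2 h3
    have := h.currentSubspace_upToLabel_le V (p + 1) (rk w p q + 1) (rk w p q)
    rwa [currentSubspace_upToLabel_of_gt _ (Nat.lt_succ_self _),
      currentSubspace_upToLabel_of_le _ le_rfl, ← h4] at this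

lemma IsCellLabelling.currentSubspace_le_stdSubspace (h : IsCellLabelling c φ)
    (V : bottSamelson c) (v : GridVertex n) :
    currentSubspace c (bottSamelsonEntries V) (upToRow (cellRow φ) v.row) (rkVec w v) ≤
      stdSubspace n v.row := by
  rw [← h.currentSubspace_upToRow (bottSamelsonEntries V) (le_refl v.row)]
  exact h.monotone_currentSubspace_upToRow V _ (rkVec_le_row w v)

/-- The subspace at a vertex that a sequence of flags determines. -/
noncomputable def vertexSubspace (φ : Fin N → {v : GridVertex n // v ∈ freeCells w})
    (V : bottSamelson c) (v : GridVertex n) : Submodule ℂ (Fin v.row → ℂ) :=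
  (currentSubspace c (bottSamelsonEntries V) (upToRow (cellRow φ) v.row) (rkVec w v)).comap
    (incl (row_le v))

lemma IsCellLabelling.map_vertexSubspace (h : IsCellLabelling c φ) (V : bottSamelson c)
    (v : GridVertex n) : (vertexSubspace φ V v).map (incl (row_le v)) =
      currentSubspace c (bottSamelsonEntries V) (upToRow (cellRow φ) v.row) (rkVec w v) := by
  rw [vertexSubspace, Submodule.map_comap_eq, ← stdSubspace_eq_range]
  exact inf_eq_right.2 (h.currentSubspace_le_stdSubspace V v)

/-- The subrepresentation that a sequence of flags determines. -/
noncomputable def IsCellLabelling.toRep (h : IsCellLabelling c φ) (V : bottSamelson c) :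
    quiverGrassmannian (gridRep n) (rkVec w) :=
  ⟨fun v => ⟨vertexSubspace φ V v, by
      have := finrank_map_incl (row_le v) (vertexSubspace φ V v)
      rw [h.map_vertexSubspace, finrank_currentSubspace (finrank_bottSamelsonEntries V) _
        ((rkVec_le_row w v).trans (row_le v))] at this
      exact this.symm⟩, by
    rintro _ _ (⟨i, i', j, hi⟩ | ⟨i, j, j', hj⟩)
    · rintro _ ⟨x, hx, rfl⟩
      have h1 := h.currentSubspace_row_le V (i + 1) (j + 1) hx
      have hi' : i.val + 1 + 1 = i'.val + 1 := by omega
      rw [hi'] at h1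
      exact incl_incl_mem (a := i.val + 1) (b := i'.val + 1) (by omega) i'.isLt h1
    · rintro _ ⟨x, hx, rfl⟩
      exact h.monotone_currentSubspace_upToRow V _
        (rk_mono le_rfl (show j.val + 1 ≤ j'.val + 1 by omega)) hx⟩

lemma IsCellLabelling.comp_toRep (h : IsCellLabelling c φ) (V : bottSamelson c)
    (v : GridVertex n) : comp (h.toRep V).1 v =
      currentSubspace c (bottSamelsonEntries V) (upToRow (cellRow φ) v.row) (rkVec w v) :=
  h.map_vertexSubspace V v

lemma IsCellLabelling.comp_toRep_cell (h : IsCellLabelling c φ) (V : bottSamelson c)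
    (k : Fin N) : comp (h.toRep V).1 (φ k).1 = (V.1 (k.succ, c k)).1 := by
  rw [h.comp_toRep, h.rk_eq]
  exact h.currentSubspace_cell (bottSamelsonEntries V) k

lemma IsCellLabelling.comp_toRep_last (h : IsCellLabelling c φ) (V : bottSamelson c)
    (j : Fin n) : comp (h.toRep V).1 (Fin.last n, j) = (V.1 (Fin.last N, j)).1 := by
  rw [bottSamelson_eq_currentSubspace]
  refine (h.comp_toRep V _).trans ?_
  have hr : rkVec w (Fin.last n, j) = j + 1 := rk_last_row (q := j + 1) (by omega)
  rw [hr]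
  refine currentSubspace_congr fun k _ => ?_
  rw [mem_upToRow, mem_initial]
  exact iff_of_true (row_le (φ k).1) k.2

/-! #### From representations to flags -/

/-- The subspaces of a representation at the cells of the letters. -/
noncomputable def repEntries (φ : Fin N → {v : GridVertex n // v ∈ freeCells w})
    (R : quiverGrassmannian (gridRep n) (rkVec w)) (k : Fin N) :
    Submodule ℂ (Fin (n + 1) → ℂ) := comp R.1 (φ k).1

lemma IsCellLabelling.finrank_repEntries (h : IsCellLabelling c φ)
    (R : quiverGrassmannian (gridRep n) (rkVec w)) (k : Fin N) :
    Module.finrank ℂ (repEntries φ R k) = label c k := by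
  rw [repEntries, finrank_comp, h.rk_eq]

lemma comp_eq_bot {R : ProdGr (rkVec w) (gridRep n).dim} {v : GridVertex n}
    (hv : rkVec w v = 0) : comp R v = ⊥ := by
  rw [← Submodule.finrank_eq_zero, finrank_comp, hv]

lemma comp_eq_of_rkVec_eq {R : ProdGr (rkVec w) (gridRep n).dim}
    (hR : R ∈ quiverGrassmannian (gridRep n) (rkVec w)) {v v' : GridVertex n}
    (hrow : v.row ≤ v'.row) (hcol : v.col ≤ v'.col) (hr : rkVec w v = rkVec w v') :
    comp R v = comp R v' :=
  Submodule.eq_of_le_of_finrank_eq (comp_mono hR hrow hcol) (by simp only [finrank_comp, hr])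

/-- A subrepresentation is determined by its subspaces at the free cells. -/
lemma IsCellLabelling.comp_eq_currentSubspace (h : IsCellLabelling c φ)
    (hφ : Function.Surjective φ) (R : quiverGrassmannian (gridRep n) (rkVec w)) :
    ∀ v : GridVertex n, comp R.1 v =
      currentSubspace c (repEntries φ R) (upToRow (cellRow φ) v.row) (rkVec w v) := by
  suffices H : ∀ s, ∀ v : GridVertex n, v.row + v.col = s → comp R.1 v =
      currentSubspace c (repEntries φ R) (upToRow (cellRow φ) v.row) (rkVec w v) from
    fun v => H _ v rfl
  intro s
  induction s using Nat.strong_induction_on with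
  | _ s ih =>
    intro v hs
    by_cases hzero : rkVec w v = 0
    · rw [comp_eq_bot hzero, hzero, currentSubspace_zero]
    have hle := rkVec_le_row w v
    rcases Nat.eq_or_lt_of_le hle with hfull | hlt
    · rw [h.currentSubspace_upToRow _ hfull.ge, hfull]
      refine Submodule.eq_of_le_of_finrank_eq (comp_le_stdSubspace _ _) ?_
      rw [finrank_comp, finrank_stdSubspace (row_le v), hfull]
    have hrow : 1 ≤ v.row := Nat.succ_pos _
    have hcol : 1 ≤ v.col := Nat.succ_pos _
    by_cases hup : rk w (v.row - 1) v.col = rk w v.row v.col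
    · obtain ⟨p, hp⟩ : ∃ p, v.row = p + 1 := ⟨v.row - 1, by omega⟩
      rw [hp, Nat.add_sub_cancel] at hup
      have hp1 : 1 ≤ p := by
        rcases Nat.eq_zero_or_pos p with rfl | hp1
        · rw [rk_zero_left] at hup
          exact absurd (by rw [rkVec, hp, ← hup]) hzero
        · exact hp1
      obtain ⟨v', hv1, hv2⟩ := exists_vertex (n := n) hp1 (by have := row_le v; omega) hcol
        (col_le v)
      have hr : rkVec w v' = rkVec w v := by simp only [rkVec, hv1, hv2, hp, hup]
      rw [← comp_eq_of_rkVec_eq R.2 (by omega) (by omega) hr, ih _ (by omega) v' rfl, hr, hp, hv1,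
        rkVec, hp, h.currentSubspace_row_eq _ hup.symm]
    by_cases hleft : rk w v.row (v.col - 1) = rk w v.row v.col
    · have hq1 : 1 ≤ v.col - 1 := by
        by_contra hc
        rw [show v.col - 1 = 0 by omega, rk_zero_right] at hleft
        exact hzero hleft.symm
      obtain ⟨v', hv1, hv2⟩ := exists_vertex (n := n) hrow (row_le v) hq1
        (by have := col_le v; omega)
      have hr : rkVec w v' = rkVec w v := by simp only [rkVec, hv1, hv2, hleft]
      rw [← comp_eq_of_rkVec_eq R.2 (by omega) (by omega) hr, ih _ (by omega) v' rfl, hr, hv1]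
    -- Once rank zero, full rank and equality with the neighbour above or to the left are excluded,
    -- only a free cell remains.
    have hfree : v ∈ freeCells w := mem_freeCells.2 ⟨hlt,
      lt_of_le_of_ne (rk_mono (Nat.sub_le _ _) le_rfl) hup,
      lt_of_le_of_ne (rk_mono le_rfl (Nat.sub_le _ _)) hleft⟩
    obtain ⟨k, hk⟩ := hφ ⟨v, hfree⟩
    obtain rfl : (φ k).1 = v := congrArg Subtype.val hk
    rw [h.rk_eq]
    exact (h.currentSubspace_cell (repEntries φ R) k).symm

/-- Every dimension below `p` occurs as a rank in row `p`, so the arrows to the right give the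
chain; from dimension `p` on it is the standard flag. -/
lemma IsCellLabelling.currentSubspace_rep_row_le (h : IsCellLabelling c φ)
    (hφ : Function.Surjective φ) (R : quiverGrassmannian (gridRep n) (rkVec w)) {p : ℕ}
    (hp : 1 ≤ p) (hp' : p ≤ n + 1) (i : ℕ) :
    currentSubspace c (repEntries φ R) (upToRow (cellRow φ) p) i ≤
      currentSubspace c (repEntries φ R) (upToRow (cellRow φ) p) (i + 1) := by
  rcases Nat.eq_zero_or_pos i with rfl | hi
  · rw [currentSubspace_zero]; exact bot_le
  rcases Nat.lt_or_ge i p with hip | hip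
  · obtain ⟨q, hq, hqi⟩ := exists_rk_eq (w := w) hp' hip
    have hq1 : 1 ≤ q := by
      by_contra hc
      rw [show q = 0 by omega, rk_zero_right] at hqi
      omega
    obtain ⟨v, rfl, rfl⟩ := exists_vertex hp hp' hq1 hq
    have hv : rkVec w v = i := hqi
    rw [← hv, ← h.comp_eq_currentSubspace hφ, hv]
    rcases Nat.eq_or_lt_of_le (Nat.succ_le_of_lt hip) with hip' | hip'
    · rw [h.currentSubspace_upToRow _ hip'.ge]
      exact (comp_le_stdSubspace _ _).trans (stdSubspace_mono hip'.ge)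
    · obtain ⟨q', hq', hqi'⟩ := exists_rk_eq (w := w) hp' hip'
      have hlt : v.col < q' := by
        by_contra hc
        have := rk_mono (w := w) (le_refl v.row) (not_lt.1 hc)
        omega
      obtain ⟨v', hv1, hv2⟩ := exists_vertex hp hp' (by omega : 1 ≤ q') hq'
      have hv' : rkVec w v' = i + 1 := by rw [rkVec, hv1, hv2, hqi']
      rw [← hv', ← hv1, ← h.comp_eq_currentSubspace hφ]
      exact comp_mono R.2 hv1.ge (by omega)
  · rw [h.currentSubspace_upToRow _ hip, h.currentSubspace_upToRow _ (by omega)]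
    exact stdSubspace_mono (Nat.le_succ i)

/-- Step down from a vertex of rank `i`: the new rank is `i + 1`, as wanted, or still `i`, and then
the chain inside row `p + 1` finishes. -/
lemma IsCellLabelling.currentSubspace_rep_le (h : IsCellLabelling c φ)
    (hφ : Function.Surjective φ) (R : quiverGrassmannian (gridRep n) (rkVec w)) {p : ℕ}
    (hp : 1 ≤ p) (hp' : p ≤ n) (i : ℕ) :
    currentSubspace c (repEntries φ R) (upToRow (cellRow φ) p) i ≤
      currentSubspace c (repEntries φ R) (upToRow (cellRow φ) (p + 1)) (i + 1) := by
  rcases Nat.eq_zero_or_pos i with rfl | hi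
  · rw [currentSubspace_zero]; exact bot_le
  rcases Nat.lt_or_ge i p with hip | hip
  · obtain ⟨q, hq, hqi⟩ := exists_rk_eq (w := w) (by omega) hip
    have hq1 : 1 ≤ q := by
      by_contra hc
      rw [show q = 0 by omega, rk_zero_right] at hqi
      omega
    obtain ⟨v, hv1, hv2⟩ := exists_vertex hp (by omega) hq1 hq
    obtain ⟨v', hv1', hv2'⟩ := exists_vertex (n := n) (by omega : 1 ≤ p + 1) (by omega) hq1 hq
    have hv : rkVec w v = i := by rw [rkVec, hv1, hv2, hqi]
    have hle : currentSubspace c (repEntries φ R) (upToRow (cellRow φ) p) i ≤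
        currentSubspace c (repEntries φ R) (upToRow (cellRow φ) (p + 1)) (rkVec w v') := by
      rw [← hv, ← hv1, ← h.comp_eq_currentSubspace hφ, hv1, ← hv1',
        ← h.comp_eq_currentSubspace hφ]
      exact comp_mono R.2 (by omega) (by omega)
    have h1 := rk_mono (w := w) (Nat.le_succ p) (le_refl q)
    have h2 := rk_succ_row_le (w := w) p q
    have hv' : rkVec w v' = rk w (p + 1) q := by rw [rkVec, hv1', hv2']
    rcases Nat.eq_or_lt_of_le h1 with h3 | h3
    · rw [hv', ← h3, hqi] at hle
      exact hle.trans (h.currentSubspace_rep_row_le hφ R (by omega) (by omega) i)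
    · rwa [hv', le_antisymm h2 h3, hqi] at hle
  · rw [h.currentSubspace_upToRow _ hip, h.currentSubspace_upToRow _ (by omega)]
    exact stdSubspace_mono (Nat.le_succ i)

lemma IsCellLabelling.currentSubspace_rep_initial_le (h : IsCellLabelling c φ)
    (hφ : Function.Surjective φ) (R : quiverGrassmannian (gridRep n) (rkVec w)) (k i : ℕ) :
    currentSubspace c (repEntries φ R) (initial N k) i ≤
      currentSubspace c (repEntries φ R) (initial N k) (i + 1) := by
  refine h.order.lastVal_initial_le (fun i => stdSubspace_mono (Nat.le_succ i)) ?_ k i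
  intro j i hi
  change currentSubspace c _ _ _ ≤ currentSubspace c _ _ _
  have hlt := h.label_lt j
  have hrow : cellRow φ j ≤ n + 1 := row_le _
  have hpos : 1 ≤ label c j := Nat.succ_pos _
  rw [currentSubspace_upToLabel_of_le _ (show label c j ≤ i + 1 by omega)]
  rcases hi with rfl | hi
  -- With `i` the label at the cut, both dimensions have completed the row; with `i + 1` the label,
  -- dimension `i` is still at the previous row.
  · rw [currentSubspace_upToLabel_of_le _ le_rfl]
    exact h.currentSubspace_rep_row_le hφ R (by omega) hrow _
  · obtain ⟨p, hp⟩ : ∃ p, cellRow φ j = p + 1 := ⟨cellRow φ j - 1, by omega⟩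
    rw [hp, currentSubspace_upToLabel_of_gt _ (show i < label c j by omega)]
    exact h.currentSubspace_rep_le hφ R (by omega) (by omega) i

/-- The sequence of flags that a subrepresentation determines. -/
noncomputable def IsCellLabelling.toFlags (h : IsCellLabelling c φ) (hφ : Function.Surjective φ)
    (R : quiverGrassmannian (gridRep n) (rkVec w)) : bottSamelson c :=
  ⟨fun x => ⟨currentSubspace c (repEntries φ R) (initial N x.1) (x.2 + 1),
      finrank_currentSubspace (h.finrank_repEntries R) _ (by omega)⟩, by
    refine ⟨fun k i j hij => ?_, fun i => ?_, fun k i hi => ?_⟩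
    · exact monotone_nat_of_le_succ (h.currentSubspace_rep_initial_le hφ R k)
        (Nat.succ_le_succ (Fin.le_def.1 hij))
    · exact lastVal_of_forall_ne fun j hj => by simp at hj
    · refine currentSubspace_congr fun j hj => ?_
      rw [mem_initial, mem_initial, Fin.val_castSucc, Fin.val_succ]
      have : j ≠ k := by
        rintro rfl
        exact hi (Fin.ext (Nat.succ_injective hj.symm))
      rw [Ne, Fin.ext_iff] at this
      omega⟩

lemma IsCellLabelling.bottSamelsonEntries_toFlags (h : IsCellLabelling c φ)
    (hφ : Function.Surjective φ) (R : quiverGrassmannian (gridRep n) (rkVec w)) :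
    bottSamelsonEntries (h.toFlags hφ R) = repEntries φ R :=
  funext fun k => currentSubspace_initial_self c (repEntries φ R) k

lemma IsCellLabelling.repEntries_toRep (h : IsCellLabelling c φ) (V : bottSamelson c) :
    repEntries φ (h.toRep V) = bottSamelsonEntries V :=
  funext fun k => h.comp_toRep_cell V k

lemma comp_injective {e : GridVertex n → ℕ} {R R' : ProdGr e (gridRep n).dim}
    (h : ∀ v, comp R v = comp R' v) : R = R' := by
  funext v
  refine Subtype.ext (Submodule.map_injective_of_injective (incl_injective (row_le v)) ?_)
  exact h v

/-- Sequences of flags correspond to subrepresentations. -/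
noncomputable def IsCellLabelling.equiv (h : IsCellLabelling c φ) (hφ : Function.Surjective φ) :
    bottSamelson c ≃ quiverGrassmannian (gridRep n) (rkVec w) where
  toFun := h.toRep
  invFun := h.toFlags hφ
  left_inv V := by
    refine Subtype.ext (funext fun x => Subtype.ext ?_)
    rw [bottSamelson_eq_currentSubspace V x.1 x.2, ← h.repEntries_toRep V]
    rfl
  right_inv R := by
    refine Subtype.ext (comp_injective fun v => ?_)
    rw [h.comp_toRep, h.bottSamelsonEntries_toFlags, h.comp_eq_currentSubspace hφ]

theorem IsCellLabelling.isVarietyIso_equiv (h : IsCellLabelling c φ)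
    (hφ : Function.Surjective φ) : IsVarietyIso (h.equiv hφ) := by
  constructor
  · refine isMorphism_of_isPluckerPolynomial fun v => ?_
    -- The component at `v` is either the entry of a fixed letter, viewed inside the coordinate
    -- subspace of row `v.row`, or a fixed standard subspace.
    rcases lastVal_cases (label c) (stdSubspace n) (upToRow (cellRow φ) v.row) (rkVec w v) with
      ⟨k, -, hk, hU⟩ | hU
    · exact isPluckerPolynomial_restrict (k.succ, c k) hk.symm (row_le v) fun V =>
        (h.map_vertexSubspace V v).trans (hU (bottSamelsonEntries V))
    · refine isPluckerPolynomial_const (W := (stdSubspace n (rkVec w v)).comap (incl (row_le v)))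
        fun V => ?_
      exact congrArg (Submodule.comap (incl (row_le v))) (hU (bottSamelsonEntries V))
  · refine isMorphism_of_isPluckerPolynomial fun x => ?_
    rcases lastVal_cases (label c) (stdSubspace n) (initial N x.1) (x.2 + 1) with
      ⟨k, -, hk, hU⟩ | hU
    · exact isPluckerPolynomial_incl (φ k).1 (hk.symm.trans (h.rk_eq k).symm) (row_le _)
        fun R => hU (repEntries φ R)
    · exact isPluckerPolynomial_const fun R => hU (repEntries φ R)

end Iso

end QuiverGr

theorem theorem2 (n N : ℕ) (w : Equiv.Perm (Fin (n + 1))) (c : Fin N → Fin n)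
    (hc : QuiverGr.IsGeomCompatible w c) :
    ∃ φ : Fin N ≃ {v : QuiverGr.GridVertex n // v ∈ QuiverGr.freeCells w},
      (∀ k, QuiverGr.rkVec w (φ k).1 = (c k).val + 1) ∧
      (∀ j k, j < k → c j = c k → (φ j).1.row < (φ k).1.row) ∧
      ∃ Φ : QuiverGr.bottSamelson c ≃
          QuiverGr.quiverGrassmannian (QuiverGr.gridRep n) (QuiverGr.rkVec w),
        QuiverGr.IsVarietyIso Φ ∧
        (∀ (V : QuiverGr.bottSamelson c) (k : Fin N),
          QuiverGr.comp (Φ V).1 (φ k).1 = (V.1 (k.succ, c k)).1) ∧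
        ∀ (V : QuiverGr.bottSamelson c) (j : Fin n),
          QuiverGr.comp (Φ V).1 (Fin.last n, j) = (V.1 (Fin.last N, j)).1 := by
  obtain ⟨φ, hrk, hord⟩ := hc.exists_equiv_freeCells
  have h : QuiverGr.IsCellLabelling c φ := ⟨hrk, fun j k hjk => by
    have := hord j k hjk
    simp only [QuiverGr.label, QuiverGr.cellRow]
    omega⟩
  refine ⟨φ, hrk, fun j k hjk hc => ?_, h.equiv φ.surjective, h.isVarietyIso_equiv φ.surjective,
    h.comp_toRep_cell, h.comp_toRep_last⟩
  have := hord j k hjk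
  rw [hc] at this
  omega
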